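/- **Setting.** Let $M\subseteq\mathbb R^d$ be open and let $V:M\to[1,\infty)$ be a smooth function whose sublevel sets $\{V\le R\}$ are compact. Call a smooth function $f$ on $M$ *tempered* if each derivative of $f$ is bounded by a constant times a power of $V$ (for $M=\mathbb R^d$ and $V=\sqrt{1+|x|^2}$: all derivatives have polynomial growth). A family of such functions is *bounded* if, for each order of derivative, constant and power can be chosen common to the family. Assume that $V$ is tempered. Let $F_i,\sigma_i,\tilde F_i,\tilde\sigma_i$ $(i=1,\dots,d)$ be tempered, put $$\mathcal K=\sum_{i=1}^d F_i\,\partial_{x_i}+\sigma_i^2\,\partial_{x_i}^2 ,$$ and let $u(t)=e^{t\mathcal K}u$, that is $u(t)(x)=\mathbb E[u(x(t))\mid x(0)=x]$, be the Markov semigroup of a diffusion in $M$ with generator $\mathcal K$. Its transition probabilities satisfy the Chapman–Kolmogorov equation and solve the forward equation when tested against $C_c^\infty(M)$. Assume that tempered functions are integrable against the transition probabilities and that the semigroup maps bounded families of tempered functions to bounded families of tempered functions, uniformly on bounded time intervals. Let $\rho>0$ be a smooth steady state density: $\rho\,dx$ is a probability measure on $M$ invariant under the semigroup. Assume that $\rho$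 decays at the boundary of $M$ (and at infinity) in the sense that $\rho$ and its first and second derivatives are integrable against every power of $V$. Write $\langle f\rangle=\int_M f\rho\,dx$. **Perturbation.** Let $G_i$ and $H_i^2$ be integrable on bounded subintervals of $[0,\infty)$. For $0<\delta\le\delta_0$ let $\rho_\delta(t)$, $t\ge 0$, be probability measures on $M$ with $\rho_\delta(0)=\rho\,dx$ that solve, in the sense of distributions on $M$, the Fokker–Planck equation $\partial_t\rho_\delta=\mathcal K_\delta(t)^*\rho_\delta$ of the perturbed system, where $$\mathcal K_\delta(t)=\mathcal K+\sum_{i=1}^d \delta G_i(t)\,\tilde F_i\,\partial_{x_i}+\delta H_i(t)^2\,\tilde\sigma_i^2\,\partial_{x_i}^2 .$$ (This is the generator of $dx_i=F_i\,dt+\sqrt2\,\sigma_i\,dW_i+\delta G_i(t)\tilde F_i\,dt+\sqrt{2\delta}\,H_i(t)\tilde\sigma_i\,d\tilde W_i$ with independent Wiener processes $W,\tilde W$.) Assume that all moments $\int V^k\,d\rho_\delta(t)$ are bounded uniformly in $0<\delta\le\delta_0$ and $t$ in bounded intervals. For an observable $u$ write $\langle u(t)\rangle_{\rho_\delta}=\int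 u\,d\rho_\delta(t)$. **Theorem.** For every tempered observable $u$ all averages and time integrals below exist, and for $t\ge0$ $$\langle u(t)\rangle_{\rho_\delta}-\langle u(t)\rangle=-\sum_{i=1}^d\int_0^t\Big\langle\frac1\rho\,\partial_{x_i}(\tilde F_i\rho)\,u(t-s)\Big\rangle\,\delta G_i(s)\,ds+\sum_{i=1}^d\int_0^t\Big\langle\Big(\partial_{x_i}^2(\tilde\sigma_i^2)+\frac2\rho\,\partial_{x_i}(\tilde\sigma_i^2)\,\partial_{x_i}\rho+\frac1\rho\,\tilde\sigma_i^2\,\partial_{x_i}^2\rho\Big)u(t-s)\Big\rangle\,\delta H_i^2(s)\,ds+O(\delta^2),$$ where the $O(\delta^2)$ is uniform for $0<\delta\le\delta_0$ and for $t$ in bounded intervals. If moreover the perturbation is homogeneous, $G_i=G$ and $H_i=H$ for all $i$, then $$\langle u(t)\rangle_{\rho_\delta}-\langle u(t)\rangle=-\int_0^t\Big\langle\frac1\rho\,\nabla\cdot(\tilde F\rho)\,u(t-s)\Big\rangle\,\delta G(s)\,ds+\int_0^t\Big\langle\Big(\nabla\cdot L_{\tilde\sigma}+\frac2\rho\,L_{\tilde\sigma}\cdot\nabla\rho+\frac1\rho\,D_{\tilde\sigma}\rho\Big)u(t-s)\Big\rangle\,\delta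 H^2(s)\,ds+O(\delta^2)$$ with the same uniformity, where $L_{\tilde\sigma}=[\partial_{x_i}(\tilde\sigma_i^2)]_{i=1}^d$ and $D_{\tilde\sigma}=\sum_{i=1}^d\tilde\sigma_i^2\,\partial_{x_i}^2$. -/

import Mathlib

open MeasureTheory ProbabilityTheory Set
open scoped ContDiff

noncomputable section

/-- The coordinate space in which the state manifold `M` lies. -/
abbrev State (d : ℕ) : Type := EuclideanSpace ℝ (Fin d)

/-- The partial derivative `∂f/∂xᵢ`. -/
def pderiv {d : ℕ} (i : Fin d) (f : State d → ℝ) (x : State d) : ℝ :=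
  fderiv ℝ f x (EuclideanSpace.single i 1)

/-- The Kolmogorov backward operator `∑ᵢ bᵢ ∂ᵢ + aᵢ ∂ᵢ²` with drift components `bᵢ` and
diagonal diffusion coefficients `aᵢ`. -/
def kolmogorovOp {d : ℕ} (b a : Fin d → State d → ℝ) (f : State d → ℝ) (x : State d) : ℝ :=
  ∑ i, (b i x * pderiv i f x + a i x * pderiv i (pderiv i f) x)

/-- The unperturbed generator `K = ∑ᵢ Fᵢ ∂ᵢ + σᵢ² ∂ᵢ²`. -/
def generator {d : ℕ} (F σ : Fin d → State d → ℝ) : (State d → ℝ) → State d → ℝ :=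
  kolmogorovOp F (fun i x => σ i x ^ 2)

/-- The generator at time `t` of the perturbed system,
`∑ᵢ Fᵢ ∂ᵢ + σᵢ² ∂ᵢ² + δ Gᵢ(t) F̃ᵢ ∂ᵢ + δ Hᵢ(t)² σ̃ᵢ² ∂ᵢ²`. -/
def perturbedGenerator {d : ℕ} (F σ F' σ' : Fin d → State d → ℝ) (G H : Fin d → ℝ → ℝ)
    (δ t : ℝ) : (State d → ℝ) → State d → ℝ :=
  kolmogorovOp (fun i x => F i x + δ * G i t * F' i x)
    (fun i x => σ i x ^ 2 + δ * H i t ^ 2 * σ' i x ^ 2)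

/-- `μ t`, `t ≥ 0`, are probability measures on `M` that start from `μ₀` and solve the
Fokker-Planck equation `∂ₜ μ = A(t)* μ` in the sense of distributions, tested against the smooth
functions with compact support in `M`. The laws at time `t` of any solution in `M` of the Itô
equation with generator `A(t)` and initial law `μ₀` are such a family. -/
structure IsFokkerPlanckSolution {d : ℕ} (M : Set (State d))
    (A : ℝ → (State d → ℝ) → State d → ℝ) (μ₀ : Measure (State d))
    (μ : ℝ → Measure (State d)) : Prop where
  initial : μ 0 = μ₀
  isProb : ∀ t, 0 ≤ t → IsProbabilityMeasure (μ t)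
  mem : ∀ t, 0 ≤ t → μ t Mᶜ = 0
  weak : ∀ φ : State d → ℝ, ContDiff ℝ ∞ φ → HasCompactSupport φ → tsupport φ ⊆ M →
    ∀ t, 0 ≤ t →
      IntervalIntegrable (fun s => ∫ x, A s φ x ∂(μ s)) volume 0 t ∧
      ∫ x, φ x ∂(μ t) = ∫ x, φ x ∂μ₀ + ∫ s in (0 : ℝ)..t, ∫ x, A s φ x ∂(μ s)

/-- `κ t x` is the law at time `t` of the diffusion in `M` with generator `A` started at `x`:
it solves the forward equation from the point mass at `x`, and the family satisfies the
Chapman-Kolmogorov equation. -/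
structure IsTransitionFunction {d : ℕ} (M : Set (State d))
    (A : (State d → ℝ) → State d → ℝ) (κ : ℝ → Kernel (State d) (State d)) : Prop where
  forward : ∀ x ∈ M, IsFokkerPlanckSolution M (fun _ => A) (Measure.dirac x) (fun t => κ t x)
  chapman : ∀ s t, 0 ≤ s → 0 ≤ t → ∀ x ∈ M, κ (s + t) x = (κ s x).bind (κ t)

/-- The Markov semigroup `(e^{tK} f)(x) = E[f(x(t)) | x(0) = x]`. -/
def semigroup {d : ℕ} (κ : ℝ → Kernel (State d) (State d)) (t : ℝ) (f : State d → ℝ)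
    (x : State d) : ℝ :=
  ∫ y, f y ∂(κ t x)

/-- A bounded family of tempered observables on `M`, relative to the weight `V`: smooth functions
on `M` each of whose derivatives is bounded by a multiple of a power of `V`, with multiple and
power common to the family. -/
def IsTemperedFamily {d : ℕ} (M : Set (State d)) (V : State d → ℝ) (S : Set (State d → ℝ)) :
    Prop :=
  (∀ f ∈ S, ContDiffOn ℝ ∞ f M) ∧
    ∀ n : ℕ, ∃ (k : ℕ) (C : ℝ), ∀ f ∈ S, ∀ x ∈ M, ‖iteratedFDeriv ℝ n f x‖ ≤ C * V x ^ k

/-- A single tempered observable. -/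
def IsTempered {d : ℕ} (M : Set (State d)) (V : State d → ℝ) (f : State d → ℝ) : Prop :=
  IsTemperedFamily M V {f}

/-- A weight on `M`: a smooth tempered function `V ≥ 1` with compact sublevel sets, so that
`V → ∞` at the boundary of `M` and at infinity. For `M = ℝᵈ` and `V = √(1 + |x|²)`, tempered
means smooth with all derivatives of polynomial growth. -/
structure IsWeight {d : ℕ} (M : Set (State d)) (V : State d → ℝ) : Prop where
  one_le : ∀ x ∈ M, 1 ≤ V x
  isCompact : ∀ R : ℝ, IsCompact {x | x ∈ M ∧ V x ≤ R}
  tempered : IsTempered M V V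

/-- The Markov semigroup acts on tempered observables: their conditional expectations exist, and
on bounded time intervals bounded families stay bounded families of tempered observables. -/
structure ActsOnTempered {d : ℕ} (M : Set (State d)) (V : State d → ℝ)
    (κ : ℝ → Kernel (State d) (State d)) : Prop where
  integrable : ∀ f, IsTempered M V f → ∀ t, 0 ≤ t → ∀ x ∈ M, Integrable f (κ t x)
  bounded : ∀ S, IsTemperedFamily M V S → ∀ T : ℝ,
    IsTemperedFamily M V {g | ∃ f ∈ S, ∃ t ∈ Icc 0 T, g = semigroup κ t f}

/-- The measure `ρ dx` on `M`. -/
def densityMeasure {d : ℕ} (M : Set (State d)) (ρ : State d → ℝ) : Measure (State d) :=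
  (volume.restrict M).withDensity (fun x => ENNReal.ofReal (ρ x))

/-- `ρ` is a smooth positive steady state density on `M`: `ρ dx` is a probability measure that is
invariant under the Markov semigroup. -/
structure IsSteadyState {d : ℕ} (M : Set (State d)) (κ : ℝ → Kernel (State d) (State d))
    (ρ : State d → ℝ) : Prop where
  smooth : ContDiffOn ℝ ∞ ρ M
  pos : ∀ x ∈ M, 0 < ρ x
  isProb : IsProbabilityMeasure (densityMeasure M ρ)
  invariant : ∀ t, 0 ≤ t → Kernel.Invariant (κ t) (densityMeasure M ρ)

/-- Decay of `ρ` towards the boundary of `M`: `ρ` and its first two derivatives are integrable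
against every power of `V`. -/
def DecaysAtBoundary {d : ℕ} (M : Set (State d)) (V ρ : State d → ℝ) : Prop :=
  ∀ k : ℕ, ∀ n ≤ 2, IntegrableOn (fun x => V x ^ k * ‖iteratedFDeriv ℝ n ρ x‖) M

/-- The steady state average `⟨f⟩ = ∫_M f ρ dx`. -/
def steadyAverage {d : ℕ} (M : Set (State d)) (ρ f : State d → ℝ) : ℝ :=
  ∫ x in M, f x * ρ x

/-- `(1/ρ) ∂ᵢ(F̃ᵢ ρ)`. -/
def driftResponse {d : ℕ} (ρ : State d → ℝ) (F' : Fin d → State d → ℝ) (i : Fin d)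
    (x : State d) : ℝ :=
  1 / ρ x * pderiv i (fun y => F' i y * ρ y) x

/-- `∂ᵢ²(σ̃ᵢ²) + (2/ρ) ∂ᵢ(σ̃ᵢ²) ∂ᵢρ + (1/ρ) σ̃ᵢ² ∂ᵢ²ρ`. -/
def noiseResponse {d : ℕ} (ρ : State d → ℝ) (σ' : Fin d → State d → ℝ) (i : Fin d)
    (x : State d) : ℝ :=
  pderiv i (pderiv i (fun y => σ' i y ^ 2)) x
    + 2 / ρ x * pderiv i (fun y => σ' i y ^ 2) x * pderiv i ρ x
    + 1 / ρ x * σ' i x ^ 2 * pderiv i (pderiv i ρ) x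

/-- The divergence of the vector field with components `Xᵢ`. -/
def divergence {d : ℕ} (X : Fin d → State d → ℝ) (x : State d) : ℝ :=
  ∑ i, pderiv i (X i) x

/-- The vector field `L_σ̃ = [∂ᵢ(σ̃ᵢ²)]ᵢ`. -/
def noiseVector {d : ℕ} (σ' : Fin d → State d → ℝ) (i : Fin d) (x : State d) : ℝ :=
  pderiv i (fun y => σ' i y ^ 2) x

/-- The operator `D_σ̃ = ∑ᵢ σ̃ᵢ² ∂ᵢ²`. -/
def noiseOp {d : ℕ} (σ' : Fin d → State d → ℝ) (f : State d → ℝ) (x : State d) : ℝ :=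
  ∑ i, σ' i x ^ 2 * pderiv i (pderiv i f) x

/-- `(1/ρ) ∇·(F̃ ρ)`. -/
def driftResponseVec {d : ℕ} (ρ : State d → ℝ) (F' : Fin d → State d → ℝ) (x : State d) : ℝ :=
  1 / ρ x * divergence (fun i y => F' i y * ρ y) x

/-- `∇·L_σ̃ + (2/ρ) L_σ̃·∇ρ + (1/ρ) D_σ̃ ρ`. -/
def noiseResponseVec {d : ℕ} (ρ : State d → ℝ) (σ' : Fin d → State d → ℝ) (x : State d) : ℝ :=
  divergence (noiseVector σ') x
    + 2 / ρ x * (∑ i, noiseVector σ' i x * pderiv i ρ x)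
    + 1 / ρ x * noiseOp σ' ρ x

end

/-!
Telescoping `s ↦ ∫ e^{(t-s)𝒦} u dρ_δ(s)` over short intervals gives Duhamel's formula
`⟨u(t)⟩_{ρ_δ} - ⟨u(t)⟩ = ∫₀ᵗ ∫ (𝒦_δ(s) - 𝒦) e^{(t-s)𝒦} u dρ_δ(s) ds`. Since `𝒦_δ - 𝒦` has size `δ`,
the laws `ρ_δ(s)` differ from `ρ dx` by `O(δ)` when tested against a bounded family of tempered
observables, so that replacing `ρ_δ(s)` by `ρ dx` on the right costs only `O(δ²)`. Integration by
parts then moves the derivatives from `e^{(t-s)𝒦} u` onto `ρ` and produces the response functions.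

The weak equations, which are given for test functions only, reach tempered observables through
cutoffs that depend on `V`: all derivatives of the truncated observables are bounded by one power of
`V` independently of the truncation, and moments of every order are controlled.
-/

open Filter Topology
open scoped Pointwise

section TemperedFamilies

variable {d : ℕ} {M : Set (State d)} {V f g : State d → ℝ} {S S' : Set (State d → ℝ)}

theorem IsTemperedFamily.mono (h : IsTemperedFamily M V S') (hS : S ⊆ S') :
    IsTemperedFamily M V S :=
  ⟨fun f hf => h.1 f (hS hf), fun n => by
    obtain ⟨k, C, hC⟩ := h.2 n
    exact ⟨k, C, fun f hf => hC f (hS hf)⟩⟩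

theorem IsTemperedFamily.isTempered (h : IsTemperedFamily M V S) (hf : f ∈ S) :
    IsTempered M V f :=
  h.mono (singleton_subset_iff.2 hf)

theorem IsTempered.contDiffOn (h : IsTempered M V f) : ContDiffOn ℝ ∞ f M :=
  h.1 f rfl

theorem IsTemperedFamily.of_eqOn (hM : IsOpen M) (h : IsTemperedFamily M V S')
    (hS : ∀ g ∈ S, ∃ f ∈ S', EqOn g f M) : IsTemperedFamily M V S := by
  refine ⟨fun g hg => ?_, fun n => ?_⟩
  · obtain ⟨f, hf, hgf⟩ := hS g hg
    exact (h.1 f hf).congr hgf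
  · obtain ⟨k, C, hC⟩ := h.2 n
    refine ⟨k, C, fun g hg x hx => ?_⟩
    obtain ⟨f, hf, hgf⟩ := hS g hg
    have hnhds : g =ᶠ[𝓝 x] f := hgf.eventuallyEq_of_mem (hM.mem_nhds hx)
    rw [(hnhds.iteratedFDeriv ℝ n).eq_of_nhds]
    exact hC f hf x hx

theorem IsTemperedFamily.iUnion {ι : Type*} [Finite ι] {S : ι → Set (State d → ℝ)}
    (hV : ∀ x ∈ M, 1 ≤ V x) (h : ∀ i, IsTemperedFamily M V (S i)) :
    IsTemperedFamily M V (⋃ i, S i) := by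
  have := Fintype.ofFinite ι
  refine ⟨fun f hf => ?_, fun n => ?_⟩
  · obtain ⟨i, hi⟩ := mem_iUnion.1 hf
    exact (h i).1 f hi
  · choose k C hC using fun i => (h i).2 n
    refine ⟨∑ i, k i, ∑ i, |C i|, fun f hf x hx => ?_⟩
    obtain ⟨i, hi⟩ := mem_iUnion.1 hf
    have hone := hV x hx
    calc ‖iteratedFDeriv ℝ n f x‖ ≤ C i * V x ^ k i := hC i f hi x hx
      _ ≤ |C i| * V x ^ k i := by gcongr; exact le_abs_self _
      _ ≤ (∑ i, |C i|) * V x ^ ∑ i, k i := by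
        gcongr
        · exact Finset.single_le_sum (f := fun i => |C i|) (fun _ _ => abs_nonneg _)
            (Finset.mem_univ i)
        · exact Finset.single_le_sum (fun _ _ => Nat.zero_le _) (Finset.mem_univ i)

theorem IsTemperedFamily.exists_bound_of_le (h : IsTemperedFamily M V S)
    (hV : ∀ x ∈ M, 1 ≤ V x) (n : ℕ) :
    ∃ (k : ℕ) (C : ℝ), 0 ≤ C ∧
      ∀ i ≤ n, ∀ f ∈ S, ∀ x ∈ M, ‖iteratedFDeriv ℝ i f x‖ ≤ C * V x ^ k := by
  choose k C hC using h.2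
  refine ⟨∑ i ∈ Finset.range (n + 1), k i, ∑ i ∈ Finset.range (n + 1), |C i|,
    Finset.sum_nonneg fun i _ => abs_nonneg _, fun i hi f hf x hx => ?_⟩
  have hone := hV x hx
  have hmem : i ∈ Finset.range (n + 1) := Finset.mem_range_succ_iff.2 hi
  calc ‖iteratedFDeriv ℝ i f x‖ ≤ C i * V x ^ k i := hC i f hf x hx
    _ ≤ |C i| * V x ^ k i := by gcongr; exact le_abs_self _
    _ ≤ _ := by
      gcongr
      · exact Finset.single_le_sum (f := fun i => |C i|) (fun _ _ => abs_nonneg _) hmem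
      · exact Finset.single_le_sum (fun _ _ => Nat.zero_le _) hmem

theorem IsTemperedFamily.exists_abs_le (h : IsTemperedFamily M V S) (hV : ∀ x ∈ M, 1 ≤ V x) :
    ∃ (k : ℕ) (C : ℝ), 0 ≤ C ∧ ∀ f ∈ S, ∀ x ∈ M, |f x| ≤ C * V x ^ k := by
  obtain ⟨k, C, hC, hb⟩ := h.exists_bound_of_le hV 0
  exact ⟨k, C, hC, fun f hf x hx => by simpa using hb 0 le_rfl f hf x hx⟩

theorem IsTempered.exists_abs_le (h : IsTempered M V f) (hV : ∀ x ∈ M, 1 ≤ V x) :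
    ∃ (k : ℕ) (C : ℝ), 0 ≤ C ∧ ∀ x ∈ M, |f x| ≤ C * V x ^ k := by
  obtain ⟨k, C, hC, hb⟩ := IsTemperedFamily.exists_abs_le h hV
  exact ⟨k, C, hC, hb f rfl⟩

theorem norm_iteratedFDeriv_mul_le_of_isOpen (hM : IsOpen M) (hf : ContDiffOn ℝ ∞ f M)
    (hg : ContDiffOn ℝ ∞ g M) {x : State d} (hx : x ∈ M) (n : ℕ) :
    ‖iteratedFDeriv ℝ n (f * g) x‖ ≤ ∑ i ∈ Finset.range (n + 1),
      (n.choose i : ℝ) * ‖iteratedFDeriv ℝ i f x‖ * ‖iteratedFDeriv ℝ (n - i) g x‖ := by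
  have := norm_iteratedFDerivWithin_mul_le hf hg hM.uniqueDiffOn hx (n := n)
    (by exact_mod_cast le_top)
  simp only [iteratedFDerivWithin_of_isOpen _ hM hx] at this
  exact this

theorem IsTemperedFamily.mul (hM : IsOpen M) (hV : ∀ x ∈ M, 1 ≤ V x)
    (hS : IsTemperedFamily M V S) (hS' : IsTemperedFamily M V S') :
    IsTemperedFamily M V (S * S') := by
  refine ⟨forall_mem_image2.2 fun f hf g hg => (hS.1 f hf).mul (hS'.1 g hg), fun n => ?_⟩
  obtain ⟨k, C, hC, hb⟩ := hS.exists_bound_of_le hV n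
  obtain ⟨l, B, -, hb'⟩ := hS'.exists_bound_of_le hV n
  refine ⟨k + l, ∑ i ∈ Finset.range (n + 1), (n.choose i : ℝ) * C * B,
    forall_mem_image2.2 fun f hf g hg x hx => ?_⟩
  refine (norm_iteratedFDeriv_mul_le_of_isOpen hM (hS.1 f hf) (hS'.1 g hg) hx n).trans ?_
  rw [Finset.sum_mul]
  refine Finset.sum_le_sum fun i hi => ?_
  have hfi := hb i (Finset.mem_range_succ_iff.1 hi) f hf x hx
  have hgi := hb' (n - i) (Nat.sub_le n i) g hg x hx
  have := hV x hx
  calc _ ≤ (n.choose i : ℝ) * (C * V x ^ k) * (B * V x ^ l) := by gcongr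
    _ = _ := by ring

theorem IsTemperedFamily.add (hM : IsOpen M) (hV : ∀ x ∈ M, 1 ≤ V x)
    (hS : IsTemperedFamily M V S) (hS' : IsTemperedFamily M V S') :
    IsTemperedFamily M V (S + S') := by
  refine ⟨forall_mem_image2.2 fun f hf g hg => (hS.1 f hf).add (hS'.1 g hg), fun n => ?_⟩
  obtain ⟨k, C, hC, hb⟩ := hS.exists_bound_of_le hV n
  obtain ⟨l, B, hB, hb'⟩ := hS'.exists_bound_of_le hV n
  refine ⟨k + l, C + B, forall_mem_image2.2 fun f hf g hg x hx => ?_⟩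
  have hcd : ∀ {h : State d → ℝ}, ContDiffOn ℝ ∞ h M → ContDiffAt ℝ n h x := fun hh =>
    (hh.contDiffAt (hM.mem_nhds hx)).of_le (by exact_mod_cast le_top)
  rw [iteratedFDeriv_add_apply (hcd (hS.1 f hf)) (hcd (hS'.1 g hg))]
  have hone := hV x hx
  calc _ ≤ C * V x ^ k + B * V x ^ l :=
        (norm_add_le _ _).trans (add_le_add (hb n le_rfl f hf x hx) (hb' n le_rfl g hg x hx))
    _ ≤ C * V x ^ (k + l) + B * V x ^ (k + l) := by
      gcongr <;> first | exact hone | omega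
    _ = _ := by ring

theorem isTemperedFamily_const {B : Set ℝ} (hB : Bornology.IsBounded B) :
    IsTemperedFamily M V (Function.const (State d) '' B) := by
  refine ⟨forall_mem_image.2 fun _ _ => contDiffOn_const, fun n => ?_⟩
  obtain ⟨C, hC⟩ := hB.exists_norm_le
  rcases n with _ | n
  · exact ⟨0, C, forall_mem_image.2 fun c hc x _ => by simpa using hC c hc⟩
  · refine ⟨0, 0, forall_mem_image.2 fun c _ x _ => ?_⟩
    have hzero : iteratedFDeriv ℝ (n + 1) (Function.const (State d) c) = 0 :=
      iteratedFDeriv_const_of_ne n.succ_ne_zero c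
    simp [hzero]

theorem isTempered_const (c : ℝ) : IsTempered M V (fun _ => c) :=
  (isTemperedFamily_const Bornology.isBounded_singleton).isTempered
    (mem_image_of_mem _ (mem_singleton c))

theorem IsTempered.mul (hM : IsOpen M) (hV : ∀ x ∈ M, 1 ≤ V x) (hf : IsTempered M V f)
    (hg : IsTempered M V g) : IsTempered M V (fun x => f x * g x) :=
  (IsTemperedFamily.mul hM hV hf hg).isTempered (mul_mem_mul rfl rfl)

theorem IsTempered.pow (hM : IsOpen M) (hV : ∀ x ∈ M, 1 ≤ V x) (hf : IsTempered M V f) (k : ℕ) :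
    IsTempered M V (fun x => f x ^ k) := by
  induction k with
  | zero => simpa only [pow_zero] using isTempered_const 1
  | succ k ih => simpa only [pow_succ] using ih.mul hM hV hf

theorem contDiffOn_pderiv (hM : IsOpen M) (hf : ContDiffOn ℝ ∞ f M) (i : Fin d) :
    ContDiffOn ℝ ∞ (pderiv i f) M :=
  (hf.fderiv_of_isOpen hM (m := ∞) (by exact_mod_cast le_top)).clm_apply contDiffOn_const

theorem norm_iteratedFDeriv_pderiv_le (hM : IsOpen M) (hf : ContDiffOn ℝ ∞ f M) (i : Fin d)
    (n : ℕ) {x : State d} (hx : x ∈ M) :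
    ‖iteratedFDeriv ℝ n (pderiv i f) x‖ ≤ ‖iteratedFDeriv ℝ (n + 1) f x‖ := by
  have h := norm_iteratedFDeriv_clm_apply_const (f := fderiv ℝ f)
    (c := (EuclideanSpace.single i 1 : State d)) (x := x) (N := ∞) (n := n)
    ((hf.fderiv_of_isOpen hM (m := ∞) (by exact_mod_cast le_top)).contDiffAt (hM.mem_nhds hx))
    (by exact_mod_cast le_top)
  rw [norm_iteratedFDeriv_fderiv, PiLp.norm_single, norm_one, one_mul] at h
  exact h

theorem IsTemperedFamily.image_pderiv (hM : IsOpen M) (hS : IsTemperedFamily M V S) (i : Fin d) :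
    IsTemperedFamily M V (pderiv i '' S) := by
  refine ⟨forall_mem_image.2 fun f hf => contDiffOn_pderiv hM (hS.1 f hf) i, fun n => ?_⟩
  obtain ⟨k, C, hb⟩ := hS.2 (n + 1)
  exact ⟨k, C, forall_mem_image.2 fun f hf x hx =>
    (norm_iteratedFDeriv_pderiv_le hM (hS.1 f hf) i n hx).trans (hb f hf x hx)⟩

theorem IsTemperedFamily.image_comp (hM : IsOpen M) (hV : ∀ x ∈ M, 1 ≤ V x)
    (hS : IsTemperedFamily M V S) {θ : ℝ → ℝ} (hθ : ContDiff ℝ ∞ θ) (hθc : HasCompactSupport θ) :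
    IsTemperedFamily M V ((θ ∘ ·) '' S) := by
  refine ⟨forall_mem_image.2 fun f hf => hθ.comp_contDiffOn (hS.1 f hf), fun n => ?_⟩
  have hbounded : ∀ i : ℕ, ∃ C : ℝ, ∀ y, ‖iteratedFDeriv ℝ i θ y‖ ≤ C := fun i =>
    (hθc.iteratedFDeriv i).exists_bound_of_continuous
      (hθ.continuous_iteratedFDeriv (by exact_mod_cast le_top))
  choose B hB using hbounded
  have hB0 : ∀ i, 0 ≤ B i := fun i => (norm_nonneg _).trans (hB i 0)
  obtain ⟨k, C, hC, hb⟩ := hS.exists_bound_of_le hV n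
  refine ⟨k * n, n.factorial * (∑ i ∈ Finset.range (n + 1), B i) * (1 + C) ^ n,
    forall_mem_image.2 fun f hf x hx => ?_⟩
  have hone : 1 ≤ (1 + C) * V x ^ k :=
    one_le_mul_of_one_le_of_one_le (by linarith) (one_le_pow₀ (hV x hx))
  have hfaa := norm_iteratedFDerivWithin_comp_le (n := n) (N := ∞) (g := θ) (f := f) (s := M)
    (t := univ) (x := x) hθ.contDiffOn (hS.1 f hf)
    (by exact_mod_cast le_top) uniqueDiffOn_univ hM.uniqueDiffOn (mapsTo_univ _ _) hx
    (C := ∑ i ∈ Finset.range (n + 1), B i) (D := (1 + C) * V x ^ k)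
    (fun i hi => by
      rw [iteratedFDerivWithin_univ]
      exact (hB i _).trans
        (Finset.single_le_sum (fun i _ => hB0 i) (Finset.mem_range_succ_iff.2 hi)))
    (fun i hi hin => by
      rw [iteratedFDerivWithin_of_isOpen _ hM hx]
      have := zero_le_one.trans (hV x hx)
      calc _ ≤ C * V x ^ k := hb i hin f hf x hx
        _ ≤ (1 + C) * V x ^ k := by gcongr; linarith
        _ ≤ _ := le_self_pow₀ hone (by omega))
  rw [iteratedFDerivWithin_of_isOpen _ hM hx] at hfaa
  refine hfaa.trans (le_of_eq ?_)
  rw [mul_pow, ← pow_mul]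
  ring

end TemperedFamilies

section TemperedOperators

variable {d : ℕ} {M : Set (State d)} {V : State d → ℝ} {D D' : (State d → ℝ) → State d → ℝ}

/-- Local operators that preserve bounded families of tempered observables. -/
structure IsTemperedOp (M : Set (State d)) (V : State d → ℝ)
    (D : (State d → ℝ) → State d → ℝ) : Prop where
  congr : ∀ x ∈ M, ∀ f g : State d → ℝ, f =ᶠ[𝓝 x] g → D f x = D g x
  image : ∀ S, IsTemperedFamily M V S → IsTemperedFamily M V (D '' S)

theorem IsTemperedOp.isTempered (hD : IsTemperedOp M V D) {f : State d → ℝ}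
    (hf : IsTempered M V f) : IsTempered M V (D f) :=
  (hD.image _ hf).isTempered (mem_image_of_mem _ rfl)

theorem IsTemperedOp.eventuallyEq (hM : IsOpen M) (hD : IsTemperedOp M V D) {f g : State d → ℝ}
    {x : State d} (hx : x ∈ M) (h : f =ᶠ[𝓝 x] g) : D f =ᶠ[𝓝 x] D g := by
  filter_upwards [hM.mem_nhds hx, h.eventuallyEq_nhds] with y hy hfg using hD.congr y hy f g hfg

theorem isTemperedOp_id : IsTemperedOp M V id :=
  ⟨fun _ _ _ _ h => h.eq_of_nhds, fun S hS => by rwa [image_id]⟩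

theorem isTemperedOp_pderiv (hM : IsOpen M) (i : Fin d) : IsTemperedOp M V (pderiv i) :=
  ⟨fun x _ f g h => by rw [pderiv, pderiv, h.fderiv_eq], fun _ hS => hS.image_pderiv hM i⟩

theorem IsTemperedOp.comp (hM : IsOpen M) (hD : IsTemperedOp M V D) (hD' : IsTemperedOp M V D') :
    IsTemperedOp M V (D ∘ D') :=
  ⟨fun x hx _ _ h => hD.congr x hx _ _ (hD'.eventuallyEq hM hx h), fun S hS => by
    rw [image_comp]
    exact hD.image _ (hD'.image S hS)⟩

theorem IsTemperedOp.mul_left (hM : IsOpen M) (hV : ∀ x ∈ M, 1 ≤ V x) {a : State d → ℝ}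
    (ha : IsTempered M V a) (hD : IsTemperedOp M V D) :
    IsTemperedOp M V fun f x => a x * D f x :=
  ⟨fun x hx f g h => by rw [hD.congr x hx f g h], fun S hS =>
    (IsTemperedFamily.mul hM hV ha (hD.image S hS)).mono <| image_subset_iff.2 fun _ hf =>
      mul_mem_mul rfl (mem_image_of_mem D hf)⟩

theorem IsTemperedOp.add (hM : IsOpen M) (hV : ∀ x ∈ M, 1 ≤ V x) (hD : IsTemperedOp M V D)
    (hD' : IsTemperedOp M V D') : IsTemperedOp M V fun f x => D f x + D' f x :=
  ⟨fun x hx f g h => by rw [hD.congr x hx f g h, hD'.congr x hx f g h], fun S hS =>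
    ((hD.image S hS).add hM hV (hD'.image S hS)).mono <| image_subset_iff.2 fun _ hf =>
      add_mem_add (mem_image_of_mem D hf) (mem_image_of_mem D' hf)⟩

theorem isTemperedOp_sum (hM : IsOpen M) (hV : ∀ x ∈ M, 1 ≤ V x) {ι : Type*} (s : Finset ι)
    {D : ι → (State d → ℝ) → State d → ℝ} (hD : ∀ j, IsTemperedOp M V (D j)) :
    IsTemperedOp M V fun f x => ∑ j ∈ s, D j f x := by
  classical
  induction s using Finset.induction_on with
  | empty =>
    simp only [Finset.sum_empty]
    exact ⟨fun _ _ _ _ _ => rfl, fun S _ =>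
      (isTempered_const 0).mono (image_subset_iff.2 fun _ _ => rfl)⟩
  | insert j s hj ih =>
    simp only [Finset.sum_insert hj]
    exact (hD j).add hM hV ih

/-- The first order operator `b ∂ᵢ`. -/
noncomputable def driftOp (b : State d → ℝ) (i : Fin d) (f : State d → ℝ) (x : State d) : ℝ :=
  b x * pderiv i f x

/-- The second order operator `a ∂ᵢ²`. -/
noncomputable def diffusionOp (a : State d → ℝ) (i : Fin d) (f : State d → ℝ) (x : State d) : ℝ :=
  a x * pderiv i (pderiv i f) x

theorem isTemperedOp_driftOp (hM : IsOpen M) (hV : ∀ x ∈ M, 1 ≤ V x) {b : State d → ℝ}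
    (hb : IsTempered M V b) (i : Fin d) : IsTemperedOp M V (driftOp b i) :=
  (isTemperedOp_pderiv hM i).mul_left hM hV hb

theorem isTemperedOp_diffusionOp (hM : IsOpen M) (hV : ∀ x ∈ M, 1 ≤ V x) {a : State d → ℝ}
    (ha : IsTempered M V a) (i : Fin d) : IsTemperedOp M V (diffusionOp a i) :=
  ((isTemperedOp_pderiv hM i).comp hM (isTemperedOp_pderiv hM i)).mul_left hM hV ha

theorem isTemperedOp_kolmogorovOp (hM : IsOpen M) (hV : ∀ x ∈ M, 1 ≤ V x)
    {b a : Fin d → State d → ℝ} (hb : ∀ i, IsTempered M V (b i)) (ha : ∀ i, IsTempered M V (a i)) :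
    IsTemperedOp M V (kolmogorovOp b a) :=
  isTemperedOp_sum hM hV Finset.univ fun i =>
    (isTemperedOp_driftOp hM hV (hb i) i).add hM hV (isTemperedOp_diffusionOp hM hV (ha i) i)

end TemperedOperators

section Truncation

variable {d : ℕ} {M : Set (State d)} {V f : State d → ℝ}

/-- A smooth cutoff in terms of the weight, equal to `1` where `|V| ≤ n + 1` and to `0` where
`|V| ≥ 2 (n + 1)`. -/
noncomputable def weightCutoff (V : State d → ℝ) (n : ℕ) (x : State d) : ℝ :=
  (⟨1, 2, one_pos, one_lt_two⟩ : ContDiffBump (0 : ℝ)) (((n : ℝ) + 1)⁻¹ * V x)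

theorem isTemperedFamily_weightCutoff (hM : IsOpen M) (hV : IsWeight M V) :
    IsTemperedFamily M V (range (weightCutoff V)) := by
  have hscale : Bornology.IsBounded (range fun n : ℕ => ((n : ℝ) + 1)⁻¹) := by
    refine isBounded_iff_forall_norm_le.2 ⟨1, forall_mem_range.2 fun n => ?_⟩
    rw [Real.norm_eq_abs, abs_of_pos (by positivity)]
    exact inv_le_one_of_one_le₀ (le_add_of_nonneg_left n.cast_nonneg)
  have hscaled := (isTemperedFamily_const hscale).mul hM hV.one_le hV.tempered
  refine (hscaled.image_comp hM hV.one_le (ContDiffBump.contDiff _)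
    (ContDiffBump.hasCompactSupport _)).mono (range_subset_iff.2 fun n => mem_image_of_mem _ ?_)
  exact mul_mem_mul (mem_image_of_mem _ (mem_range_self n)) rfl

theorem weightCutoff_eq_one {n : ℕ} {x : State d} (hnonneg : 0 ≤ V x) (hle : V x ≤ n + 1) :
    weightCutoff V n x = 1 := by
  refine ContDiffBump.one_of_mem_closedBall _ ?_
  rw [mem_closedBall_zero_iff, Real.norm_eq_abs, abs_of_nonneg (by positivity)]
  exact (inv_mul_le_one₀ (by positivity)).2 hle

theorem le_of_weightCutoff_ne_zero {n : ℕ} {x : State d} (h : weightCutoff V n x ≠ 0) :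
    V x ≤ 2 * (n + 1) := by
  contrapose! h
  refine ContDiffBump.zero_of_le_dist _ ?_
  rw [dist_zero_right, Real.norm_eq_abs]
  refine le_trans ?_ (le_abs_self _)
  rw [inv_mul_eq_div, le_div_iff₀ (by positivity)]
  exact h.le

/-- The product of `f` with the `n`-th cutoff, extended by zero outside `M`: a test function for
the Fokker-Planck equation on `M`. -/
noncomputable def truncate (M : Set (State d)) (V f : State d → ℝ) (n : ℕ) : State d → ℝ :=
  M.indicator (weightCutoff V n * f)

theorem tsupport_truncate_subset_sublevel (hV : IsWeight M V) (f : State d → ℝ) (n : ℕ) :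
    tsupport (truncate M V f n) ⊆ {x | x ∈ M ∧ V x ≤ 2 * (n + 1)} := by
  refine closure_minimal (fun x hx => ?_) (hV.isCompact _).isClosed
  rw [Function.mem_support, truncate, indicator_apply_ne_zero] at hx
  exact ⟨hx.1, le_of_weightCutoff_ne_zero (left_ne_zero_of_mul hx.2)⟩

theorem tsupport_truncate_subset (hV : IsWeight M V) (f : State d → ℝ) (n : ℕ) :
    tsupport (truncate M V f n) ⊆ M :=
  (tsupport_truncate_subset_sublevel hV f n).trans fun _ hx => hx.1

theorem hasCompactSupport_truncate (hV : IsWeight M V) (f : State d → ℝ) (n : ℕ) :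
    HasCompactSupport (truncate M V f n) :=
  (hV.isCompact _).of_isClosed_subset (isClosed_tsupport _)
    (tsupport_truncate_subset_sublevel hV f n)

theorem isTemperedFamily_truncate (hM : IsOpen M) (hV : IsWeight M V) (hf : IsTempered M V f) :
    IsTemperedFamily M V (range (truncate M V f)) :=
  ((isTemperedFamily_weightCutoff hM hV).mul hM hV.one_le hf).of_eqOn hM <|
    forall_mem_range.2 fun n => ⟨_, mul_mem_mul (mem_range_self n) rfl, eqOn_indicator⟩

theorem contDiff_truncate (hM : IsOpen M) (hV : IsWeight M V) (hf : IsTempered M V f) (n : ℕ) :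
    ContDiff ℝ ∞ (truncate M V f n) := by
  refine contDiff_iff_contDiffAt.2 fun x => ?_
  by_cases hx : x ∈ M
  · exact ((isTemperedFamily_truncate hM hV hf).1 _ (mem_range_self n)).contDiffAt
      (hM.mem_nhds hx)
  · have hzero : truncate M V f n =ᶠ[𝓝 x] fun _ => 0 :=
      notMem_tsupport_iff_eventuallyEq.1 fun h => hx (tsupport_truncate_subset hV f n h)
    exact contDiffAt_const.congr_of_eventuallyEq hzero

theorem truncate_eventuallyEq (hM : IsOpen M) (hV : IsWeight M V) (f : State d → ℝ) {n : ℕ}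
    {x : State d} (hx : x ∈ M) (hn : V x < n + 1) : truncate M V f n =ᶠ[𝓝 x] f := by
  have hcont : ContinuousAt V x :=
    hV.tempered.contDiffOn.continuousOn.continuousAt (hM.mem_nhds hx)
  filter_upwards [hM.mem_nhds hx, hcont.eventually_lt_const hn] with y hy hlt
  rw [truncate, indicator_of_mem hy, Pi.mul_apply,
    weightCutoff_eq_one (zero_le_one.trans (hV.one_le y hy)) hlt.le, one_mul]

theorem IsTemperedOp.eventually_truncate_eq (hM : IsOpen M) (hV : IsWeight M V)
    {D : (State d → ℝ) → State d → ℝ} (hD : IsTemperedOp M V D) (f : State d → ℝ) {x : State d}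
    (hx : x ∈ M) : ∀ᶠ n in atTop, D (truncate M V f n) x = D f x := by
  obtain ⟨N, hN⟩ := exists_nat_gt (V x)
  filter_upwards [eventually_ge_atTop N] with n hn
  have hle : (N : ℝ) ≤ n := by exact_mod_cast hn
  exact hD.congr x hx _ _ (truncate_eventuallyEq hM hV f hx (by linarith))

end Truncation

section Moments

variable {d : ℕ} {M : Set (State d)} {V f : State d → ℝ} {ν : Measure (State d)}
  {E : Set (Measure (State d))} {S : Set (State d → ℝ)}

theorem aestronglyMeasurable_of_continuousOn (hM : IsOpen M) (hν : ν Mᶜ = 0)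
    (hf : ContinuousOn f M) : AEStronglyMeasurable f ν := by
  rw [← Measure.restrict_eq_self_of_ae_mem (mem_ae_iff.2 hν)]
  exact hf.aestronglyMeasurable hM.measurableSet

theorem abs_integral_le_mul_of_abs_le (hν : ν Mᶜ = 0) {k : ℕ}
    (hk : Integrable (fun x => V x ^ k) ν) {C : ℝ} (hf : ∀ x ∈ M, |f x| ≤ C * V x ^ k) :
    |∫ x, f x ∂ν| ≤ C * ∫ x, V x ^ k ∂ν := by
  rw [← integral_const_mul]
  refine norm_integral_le_of_norm_le (f := f) (hk.const_mul C) ?_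
  filter_upwards [mem_ae_iff.2 hν] with x hx using hf x hx

/-- A set of measures on `M` all of whose moments, that is integrals of powers of `V`, are
uniformly bounded. Such sets are in duality with bounded families of tempered observables. -/
structure HasBoundedMoments (M : Set (State d)) (V : State d → ℝ) (E : Set (Measure (State d))) :
    Prop where
  measure_compl : ∀ ν ∈ E, ν Mᶜ = 0
  moment : ∀ k : ℕ, ∃ C : ℝ, ∀ ν ∈ E, Integrable (fun x => V x ^ k) ν ∧ ∫ x, V x ^ k ∂ν ≤ C

theorem HasBoundedMoments.integrable_pow (hE : HasBoundedMoments M V E) (hν : ν ∈ E) (k : ℕ) :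
    Integrable (fun x => V x ^ k) ν := by
  obtain ⟨C, hC⟩ := hE.moment k
  exact (hC ν hν).1

theorem HasBoundedMoments.integrable (hM : IsOpen M) (hV : ∀ x ∈ M, 1 ≤ V x)
    (hE : HasBoundedMoments M V E) (hν : ν ∈ E) (hf : IsTempered M V f) : Integrable f ν := by
  obtain ⟨k, C, -, hb⟩ := hf.exists_abs_le hV
  have hνM := hE.measure_compl ν hν
  refine ((hE.integrable_pow hν k).const_mul C).mono'
    (aestronglyMeasurable_of_continuousOn hM hνM hf.contDiffOn.continuousOn) ?_
  filter_upwards [mem_ae_iff.2 hνM] with x hx using hb x hx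

theorem HasBoundedMoments.exists_abs_integral_le_mul (hE : HasBoundedMoments M V E) (k : ℕ) :
    ∃ B : ℝ, 0 ≤ B ∧ ∀ ν ∈ E, ∀ (f : State d → ℝ) (C : ℝ), 0 ≤ C →
      (∀ x ∈ M, |f x| ≤ C * V x ^ k) → |∫ x, f x ∂ν| ≤ C * B := by
  obtain ⟨B, hB⟩ := hE.moment k
  refine ⟨max B 0, le_max_right _ _, fun ν hν f C hC hf => ?_⟩
  obtain ⟨hint, hle⟩ := hB ν hν
  calc |∫ x, f x ∂ν| ≤ C * ∫ x, V x ^ k ∂ν :=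
        abs_integral_le_mul_of_abs_le (hE.measure_compl ν hν) hint hf
    _ ≤ C * max B 0 := by gcongr; exact hle.trans (le_max_left _ _)

theorem HasBoundedMoments.exists_abs_integral_le (hV : ∀ x ∈ M, 1 ≤ V x)
    (hE : HasBoundedMoments M V E) (hS : IsTemperedFamily M V S) :
    ∃ C : ℝ, 0 ≤ C ∧ ∀ ν ∈ E, ∀ f ∈ S, |∫ x, f x ∂ν| ≤ C := by
  obtain ⟨k, C, hC, hb⟩ := hS.exists_abs_le hV
  obtain ⟨B, hB, hint⟩ := hE.exists_abs_integral_le_mul k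
  exact ⟨C * B, by positivity, fun ν hν f hf => hint ν hν f C hC (hb f hf)⟩

theorem HasBoundedMoments.tendsto_integral_truncate (hM : IsOpen M) (hV : IsWeight M V)
    (hE : HasBoundedMoments M V E) (hν : ν ∈ E) {D : (State d → ℝ) → State d → ℝ}
    (hD : IsTemperedOp M V D) (hf : IsTempered M V f) :
    Tendsto (fun n => ∫ x, D (truncate M V f n) x ∂ν) atTop (𝓝 (∫ x, D f x ∂ν)) := by
  have htrunc := hD.image _ (isTemperedFamily_truncate hM hV hf)
  obtain ⟨k, C, -, hb⟩ := htrunc.exists_abs_le hV.one_le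
  have hνM := hE.measure_compl ν hν
  refine tendsto_integral_of_dominated_convergence (fun x => C * V x ^ k) (fun n => ?_)
    ((hE.integrable_pow hν k).const_mul C) (fun n => ?_) ?_
  · exact aestronglyMeasurable_of_continuousOn hM hνM
      (htrunc.1 _ (mem_image_of_mem D (mem_range_self n))).continuousOn
  · filter_upwards [mem_ae_iff.2 hνM] with x hx
    exact hb _ (mem_image_of_mem D (mem_range_self n)) x hx
  · filter_upwards [mem_ae_iff.2 hνM] with x hx
    exact tendsto_const_nhds.congr' ((hD.eventually_truncate_eq hM hV f hx).mono fun _ h => h.symm)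

end Moments

section Integrals

theorem intervalIntegrable_of_mem_Icc {f : ℝ → ℝ} {a b s t : ℝ}
    (hf : IntervalIntegrable f volume a b) (hs : s ∈ Icc a b) (ht : t ∈ Icc a b) :
    IntervalIntegrable f volume s t :=
  hf.mono_set (uIcc_subset_uIcc (Icc_subset_uIcc hs) (Icc_subset_uIcc ht))

theorem intervalIntegrable_sum_mul {ι : Type*} [Fintype ι] {c b : ι → ℝ → ℝ} {s t : ℝ}
    (hc : ∀ j, IntervalIntegrable (c j) volume s t) (hb : ∀ j, ContinuousOn (b j) (uIcc s t)) :
    IntervalIntegrable (fun r => ∑ j, c j r * b j r) volume s t := by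
  simpa only [Finset.sum_fn] using
    IntervalIntegrable.sum Finset.univ fun j _ => (hc j).mul_continuousOn (hb j)

theorem abs_integral_sub_integral_le {f g m : ℝ → ℝ} {a b : ℝ} (hab : a ≤ b)
    (hf : IntervalIntegrable f volume a b) (hg : IntervalIntegrable g volume a b)
    (hm : IntervalIntegrable m volume a b) (hle : ∀ r ∈ Icc a b, |f r - g r| ≤ m r) :
    |(∫ r in a..b, f r) - ∫ r in a..b, g r| ≤ ∫ r in a..b, m r := by
  rw [← intervalIntegral.integral_sub hf hg]
  exact intervalIntegral.norm_integral_le_of_norm_le (f := fun r => f r - g r) hab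
    (ae_of_all _ fun r hr => hle r (Ioc_subset_Icc_self hr)) hm

theorem intervalIntegrable_of_tendsto_of_abs_le {F : ℕ → ℝ → ℝ} {f m : ℝ → ℝ} {a b : ℝ}
    (hF : ∀ n, IntervalIntegrable (F n) volume a b) (hm : IntervalIntegrable m volume a b)
    (hbound : ∀ n, ∀ s ∈ uIoc a b, |F n s| ≤ m s)
    (hlim : ∀ s ∈ uIoc a b, Tendsto (fun n => F n s) atTop (𝓝 (f s))) :
    IntervalIntegrable f volume a b := by
  refine hm.mono_fun' (aestronglyMeasurable_of_tendsto_ae atTop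
    (fun n => (hF n).def'.aestronglyMeasurable) ?_) ?_
  · exact ae_restrict_of_forall_mem measurableSet_uIoc hlim
  · exact ae_restrict_of_forall_mem measurableSet_uIoc fun s hs =>
      le_of_tendsto (hlim s hs).abs (Eventually.of_forall fun n => hbound n s hs)

theorem integral_bind_kernel {X Y : Type*} [MeasurableSpace X] [MeasurableSpace Y]
    {ν : Measure X} {κ : Kernel X Y} {f : Y → ℝ} (hf : Integrable f (ν.bind κ)) :
    ∫ y, f y ∂(ν.bind κ) = ∫ x, ∫ y, f y ∂(κ x) ∂ν := by
  have hcomp : (κ ∘ₖ Kernel.const Unit ν) () = ν.bind κ := by simp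
  rw [← hcomp] at hf ⊢
  simpa using Kernel.integral_comp hf

end Integrals

section Perturbation

variable {d : ℕ} {M : Set (State d)} {V f : State d → ℝ} {ι : Type*}
  {K : (State d → ℝ) → State d → ℝ} {c : ι → ℝ → ℝ} {D : ι → (State d → ℝ) → State d → ℝ}
  {E : Set (Measure (State d))} {S : Set (State d → ℝ)} {T : ℝ}
  {μ₀ ν : Measure (State d)} {μ : ℝ → Measure (State d)}

/-- The data common to all the perturbed systems `K + ∑ⱼ cⱼ(t) Dⱼ`: operators on tempered
observables and a set of measures with bounded moments that is to contain the laws. -/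
structure IsTemperedSystem (M : Set (State d)) (V : State d → ℝ)
    (K : (State d → ℝ) → State d → ℝ) (D : ι → (State d → ℝ) → State d → ℝ)
    (E : Set (Measure (State d))) : Prop where
  isOpen : IsOpen M
  weight : IsWeight M V
  generator : IsTemperedOp M V K
  perturbation : ∀ j, IsTemperedOp M V (D j)
  moments : HasBoundedMoments M V E

theorem IsTemperedSystem.integrable (h : IsTemperedSystem M V K D E) (hν : ν ∈ E)
    (hf : IsTempered M V f) : Integrable f ν :=
  h.moments.integrable h.isOpen h.weight.one_le hν hf

theorem IsTemperedSystem.isTemperedFamily_perturbation [Finite ι]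
    (h : IsTemperedSystem M V K D E) (hS : IsTemperedFamily M V S) :
    IsTemperedFamily M V (⋃ j, D j '' S) :=
  .iUnion h.weight.one_le fun j => (h.perturbation j).image S hS

variable [Fintype ι]

/-- The generator `K + ∑ⱼ cⱼ(t) Dⱼ` of a system perturbed by operators `Dⱼ` with time-dependent
amplitudes `cⱼ`. -/
noncomputable def perturbedOp (K : (State d → ℝ) → State d → ℝ) (c : ι → ℝ → ℝ)
    (D : ι → (State d → ℝ) → State d → ℝ) (t : ℝ) (f : State d → ℝ) (x : State d) : ℝ :=
  K f x + ∑ j, c j t * D j f x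

/-- The total amplitude `∑ⱼ |cⱼ(t)|` of a perturbation. -/
def perturbationSize (c : ι → ℝ → ℝ) (t : ℝ) : ℝ :=
  ∑ j, |c j t|

theorem perturbationSize_nonneg (c : ι → ℝ → ℝ) (t : ℝ) : 0 ≤ perturbationSize c t :=
  Finset.sum_nonneg fun _ _ => abs_nonneg _

theorem abs_sum_mul_le {B : ℝ} {b : ι → ℝ} (hb : ∀ j, |b j| ≤ B) (c : ι → ℝ → ℝ) (t : ℝ) :
    |∑ j, c j t * b j| ≤ B * perturbationSize c t := by
  calc |∑ j, c j t * b j| ≤ ∑ j, |c j t| * |b j| := by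
        simpa only [abs_mul] using Finset.abs_sum_le_sum_abs (fun j => c j t * b j) Finset.univ
    _ ≤ ∑ j, |c j t| * B := by gcongr with j; exact hb j
    _ = B * perturbationSize c t := by rw [perturbationSize, ← Finset.sum_mul, mul_comm]

theorem intervalIntegrable_perturbationSize {a b : ℝ}
    (hc : ∀ j, IntervalIntegrable (c j) volume a b) :
    IntervalIntegrable (perturbationSize c) volume a b := by
  have hsum := IntervalIntegrable.sum Finset.univ fun j _ => (hc j).abs
  rwa [Finset.sum_fn] at hsum

theorem integral_perturbationSize_nonneg {a b : ℝ} (hab : a ≤ b) :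
    0 ≤ ∫ r in a..b, perturbationSize c r :=
  intervalIntegral.integral_nonneg hab fun r _ => perturbationSize_nonneg c r

theorem integral_perturbationSize_mono {a b s t : ℝ}
    (hc : IntervalIntegrable (perturbationSize c) volume a b) (has : a ≤ s) (hst : s ≤ t)
    (htb : t ≤ b) : ∫ r in s..t, perturbationSize c r ≤ ∫ r in a..b, perturbationSize c r :=
  intervalIntegral.integral_mono_interval has hst htb
    (Eventually.of_forall fun r => perturbationSize_nonneg c r) hc

/-- A solution `μ` of the Fokker-Planck equation of the perturbed system `K + ∑ⱼ cⱼ(t) Dⱼ` whose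
laws stay in `E` up to the time `T`. -/
structure IsPerturbedFlow (M : Set (State d)) (K : (State d → ℝ) → State d → ℝ)
    (c : ι → ℝ → ℝ) (D : ι → (State d → ℝ) → State d → ℝ) (E : Set (Measure (State d))) (T : ℝ)
    (μ₀ : Measure (State d)) (μ : ℝ → Measure (State d)) : Prop where
  intervalIntegrable : ∀ j, IntervalIntegrable (c j) volume 0 T
  solution : IsFokkerPlanckSolution M (perturbedOp K c D) μ₀ μ
  mem : ∀ t ∈ Icc 0 T, μ t ∈ E

theorem IsTemperedSystem.integral_perturbedOp (h : IsTemperedSystem M V K D E) (hν : ν ∈ E)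
    (hf : IsTempered M V f) (c : ι → ℝ → ℝ) (s : ℝ) :
    ∫ x, perturbedOp K c D s f x ∂ν = ∫ x, K f x ∂ν + ∑ j, c j s * ∫ x, D j f x ∂ν := by
  have hDf : ∀ j, Integrable (fun x => c j s * D j f x) ν := fun j =>
    (h.integrable hν ((h.perturbation j).isTempered hf)).const_mul _
  simp only [perturbedOp]
  rw [integral_add (h.integrable hν (h.generator.isTempered hf))
    (integrable_finsetSum _ fun j _ => hDf j), integral_finsetSum _ fun j _ => hDf j]
  simp only [integral_const_mul]

theorem IsTemperedSystem.exists_abs_integral_perturbedOp_le (h : IsTemperedSystem M V K D E)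
    (hS : IsTemperedFamily M V S) :
    ∃ B : ℝ, 0 ≤ B ∧ ∀ ν ∈ E, ∀ f ∈ S, ∀ (c : ι → ℝ → ℝ) (s : ℝ),
      |∫ x, perturbedOp K c D s f x ∂ν| ≤ B * (1 + perturbationSize c s) := by
  obtain ⟨B, hB, hK⟩ := h.moments.exists_abs_integral_le h.weight.one_le (h.generator.image S hS)
  obtain ⟨B', hB', hD⟩ := h.moments.exists_abs_integral_le h.weight.one_le
    (h.isTemperedFamily_perturbation hS)
  refine ⟨B + B', add_nonneg hB hB', fun ν hν f hf c s => ?_⟩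
  rw [h.integral_perturbedOp hν (hS.isTempered hf)]
  have hunperturbed := hK ν hν _ (mem_image_of_mem K hf)
  have hperturbation := abs_sum_mul_le
    (fun j => hD ν hν _ (mem_iUnion_of_mem j (mem_image_of_mem (D j) hf))) c s
  have hsize := perturbationSize_nonneg c s
  refine (abs_add_le _ _).trans ((add_le_add hunperturbed hperturbation).trans ?_)
  nlinarith

theorem IsTemperedSystem.tendsto_integral_perturbedOp_truncate (h : IsTemperedSystem M V K D E)
    (hν : ν ∈ E) (hf : IsTempered M V f) (c : ι → ℝ → ℝ) (s : ℝ) :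
    Tendsto (fun n => ∫ x, perturbedOp K c D s (truncate M V f n) x ∂ν) atTop
      (𝓝 (∫ x, perturbedOp K c D s f x ∂ν)) := by
  have htrunc := fun n => (isTemperedFamily_truncate h.isOpen h.weight hf).isTempered
    (mem_range_self n)
  simp only [h.integral_perturbedOp hν hf, fun n => h.integral_perturbedOp hν (htrunc n)]
  have hlim : ∀ {A : (State d → ℝ) → State d → ℝ}, IsTemperedOp M V A →
      Tendsto (fun n => ∫ x, A (truncate M V f n) x ∂ν) atTop (𝓝 (∫ x, A f x ∂ν)) :=
    fun hA => h.moments.tendsto_integral_truncate h.isOpen h.weight hν hA hf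
  exact (hlim h.generator).add (tendsto_finsetSum _ fun j _ =>
    (hlim (h.perturbation j)).const_mul _)

theorem IsPerturbedFlow.intervalIntegrable_size (hμ : IsPerturbedFlow M K c D E T μ₀ μ) {s t : ℝ}
    (hs : 0 ≤ s) (hst : s ≤ t) (ht : t ≤ T) :
    IntervalIntegrable (perturbationSize c) volume s t :=
  intervalIntegrable_perturbationSize fun j => intervalIntegrable_of_mem_Icc
    (hμ.intervalIntegrable j) ⟨hs, hst.trans ht⟩ ⟨hs.trans hst, ht⟩

/-- The weak formulation extends from test functions to tempered observables, by dominated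
convergence along truncations. -/
theorem IsPerturbedFlow.integral_eq_add_integral (hμ : IsPerturbedFlow M K c D E T μ₀ μ)
    (h : IsTemperedSystem M V K D E) (hf : IsTempered M V f) {t : ℝ} (ht : t ∈ Icc 0 T) :
    IntervalIntegrable (fun s => ∫ x, perturbedOp K c D s f x ∂(μ s)) volume 0 t ∧
      ∫ x, f x ∂(μ t) = ∫ x, f x ∂μ₀ + ∫ s in (0 : ℝ)..t, ∫ x, perturbedOp K c D s f x ∂(μ s) := by
  have h0 : (0 : ℝ) ∈ Icc 0 T := ⟨le_rfl, ht.1.trans ht.2⟩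
  have hmem : ∀ s ∈ uIoc 0 t, μ s ∈ E := fun s hs => by
    rw [uIoc_of_le ht.1] at hs
    exact hμ.mem s ⟨hs.1.le, hs.2.trans ht.2⟩
  have hweak := fun n => hμ.solution.weak (truncate M V f n)
    (contDiff_truncate h.isOpen h.weight hf n) (hasCompactSupport_truncate h.weight f n)
    (tsupport_truncate_subset h.weight f n) t ht.1
  obtain ⟨B, -, hB⟩ := h.exists_abs_integral_perturbedOp_le
    (isTemperedFamily_truncate h.isOpen h.weight hf)
  have hbound : ∀ n, ∀ s ∈ uIoc 0 t, |∫ x, perturbedOp K c D s (truncate M V f n) x ∂(μ s)|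
      ≤ B * (1 + perturbationSize c s) := fun n s hs => hB _ (hmem s hs) _ (mem_range_self n) c s
  have hsize : IntervalIntegrable (fun s => B * (1 + perturbationSize c s)) volume 0 t :=
    (intervalIntegrable_const.add (hμ.intervalIntegrable_size le_rfl ht.1 ht.2)).const_mul B
  have hlim := fun s hs => h.tendsto_integral_perturbedOp_truncate (hmem s hs) hf c s
  refine ⟨intervalIntegrable_of_tendsto_of_abs_le (fun n => (hweak n).1) hsize hbound hlim, ?_⟩
  have hrhs := intervalIntegral.tendsto_integral_filter_of_dominated_convergence _
    (Eventually.of_forall fun n => (hweak n).1.def'.aestronglyMeasurable)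
    (Eventually.of_forall fun n => ae_of_all _ (hbound n)) hsize (ae_of_all _ hlim)
  have hvalue : ∀ {ν}, ν ∈ E → Tendsto (fun n => ∫ x, truncate M V f n x ∂ν) atTop
      (𝓝 (∫ x, f x ∂ν)) := fun hν =>
    h.moments.tendsto_integral_truncate h.isOpen h.weight hν isTemperedOp_id hf
  refine tendsto_nhds_unique (hvalue (hμ.mem t ht)) ?_
  simp only [fun n => (hweak n).2]
  exact (hvalue (hμ.solution.initial ▸ hμ.mem 0 h0)).add hrhs

theorem IsPerturbedFlow.integral_sub_integral_eq (hμ : IsPerturbedFlow M K c D E T μ₀ μ)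
    (h : IsTemperedSystem M V K D E) (hf : IsTempered M V f) {s t : ℝ} (hs : s ∈ Icc 0 T)
    (ht : t ∈ Icc 0 T) :
    ∫ x, f x ∂(μ t) - ∫ x, f x ∂(μ s) = ∫ r in s..t, ∫ x, perturbedOp K c D r f x ∂(μ r) := by
  obtain ⟨hsi, hs_eq⟩ := hμ.integral_eq_add_integral h hf hs
  obtain ⟨hti, ht_eq⟩ := hμ.integral_eq_add_integral h hf ht
  rw [hs_eq, ht_eq, ← intervalIntegral.integral_interval_sub_left hti hsi]
  ring

theorem IsPerturbedFlow.continuousOn_integral (hμ : IsPerturbedFlow M K c D E T μ₀ μ)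
    (h : IsTemperedSystem M V K D E) (hf : IsTempered M V f) :
    ContinuousOn (fun t => ∫ x, f x ∂(μ t)) (Icc 0 T) := by
  rcases lt_or_ge T 0 with hT | hT
  · simp [Icc_eq_empty_of_lt hT]
  obtain ⟨hint, -⟩ := hμ.integral_eq_add_integral h hf (right_mem_Icc.2 hT)
  have hprim := intervalIntegral.continuousOn_primitive_interval' hint left_mem_uIcc
  rw [uIcc_of_le hT] at hprim
  exact (continuousOn_const.add hprim).congr fun t ht => (hμ.integral_eq_add_integral h hf ht).2

theorem IsTemperedSystem.exists_abs_integral_sub_integral_le (h : IsTemperedSystem M V K D E)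
    (hS : IsTemperedFamily M V S) :
    ∃ B : ℝ, 0 ≤ B ∧ ∀ (c : ι → ℝ → ℝ) (T : ℝ) (μ₀ : Measure (State d))
      (μ : ℝ → Measure (State d)), IsPerturbedFlow M K c D E T μ₀ μ → ∀ f ∈ S, ∀ s t, 0 ≤ s →
        s ≤ t → t ≤ T →
          |∫ x, f x ∂(μ t) - ∫ x, f x ∂(μ s)|
            ≤ B * (t - s + ∫ r in s..t, perturbationSize c r) := by
  obtain ⟨B, hB, hbound⟩ := h.exists_abs_integral_perturbedOp_le hS
  refine ⟨B, hB, fun c T μ₀ μ hμ f hf s t hs hst ht => ?_⟩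
  have hsize := hμ.intervalIntegrable_size hs hst ht
  have hcalc : ∫ r in s..t, B * (1 + perturbationSize c r)
      = B * (t - s + ∫ r in s..t, perturbationSize c r) := by
    rw [intervalIntegral.integral_const_mul,
      intervalIntegral.integral_add intervalIntegrable_const hsize]
    simp
  rw [hμ.integral_sub_integral_eq h (hS.isTempered hf) ⟨hs, hst.trans ht⟩ ⟨hs.trans hst, ht⟩,
    ← hcalc]
  exact intervalIntegral.norm_integral_le_of_norm_le
    (f := fun r => ∫ x, perturbedOp K c D r f x ∂(μ r)) hst
    (ae_of_all _ fun r hr => hbound _ (hμ.mem r ⟨hs.trans hr.1.le, hr.2.trans ht⟩) f hf c r)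
    ((intervalIntegrable_const.add hsize).const_mul B)

end Perturbation

section Semigroup

variable {d : ℕ} {M : Set (State d)} {V f : State d → ℝ} {K : (State d → ℝ) → State d → ℝ}
  {κ : ℝ → Kernel (State d) (State d)} {S : Set (State d → ℝ)} {x : State d}

theorem ActsOnTempered.isTempered_semigroup (hκV : ActsOnTempered M V κ) (hf : IsTempered M V f)
    {t : ℝ} (ht : 0 ≤ t) : IsTempered M V (semigroup κ t f) :=
  (hκV.bounded _ hf t).isTempered ⟨f, rfl, t, right_mem_Icc.2 ht, rfl⟩

theorem ActsOnTempered.exists_abs_semigroup_le (hκV : ActsOnTempered M V κ)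
    (hV : ∀ x ∈ M, 1 ≤ V x) (hS : IsTemperedFamily M V S) (T : ℝ) :
    ∃ (k : ℕ) (C : ℝ), 0 ≤ C ∧ ∀ f ∈ S, ∀ t ∈ Icc 0 T, ∀ x ∈ M,
      |semigroup κ t f x| ≤ C * V x ^ k := by
  obtain ⟨k, C, hC, hb⟩ := (hκV.bounded S hS T).exists_abs_le hV
  exact ⟨k, C, hC, fun f hf t ht x hx => hb _ ⟨f, hf, t, ht, rfl⟩ x hx⟩

theorem ActsOnTempered.hasBoundedMoments (hκV : ActsOnTempered M V κ) (hM : IsOpen M)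
    (hV : IsWeight M V) (hκ : IsTransitionFunction M K κ) (hx : x ∈ M) (T : ℝ) :
    HasBoundedMoments M V ((fun t => κ t x) '' Icc 0 T) := by
  refine ⟨forall_mem_image.2 fun t ht => (hκ.forward x hx).mem t ht.1, fun k => ?_⟩
  have hVk := hV.tempered.pow hM hV.one_le k
  obtain ⟨l, C, -, hC⟩ := hκV.exists_abs_semigroup_le hV.one_le hVk T
  exact ⟨C * V x ^ l, forall_mem_image.2 fun t ht => ⟨hκV.integrable _ hVk t ht.1 x hx,
    (le_abs_self _).trans (hC _ rfl t ht x hx)⟩⟩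

theorem IsTransitionFunction.isPerturbedFlow (hκ : IsTransitionFunction M K κ) (hx : x ∈ M)
    (T : ℝ) : IsPerturbedFlow M K (isEmptyElim : Empty → ℝ → ℝ) isEmptyElim
      ((fun t => κ t x) '' Icc 0 T) T (Measure.dirac x) (fun t => κ t x) where
  intervalIntegrable := isEmptyElim
  solution := by
    convert hκ.forward x hx using 1
    ext t f y
    simp [perturbedOp]
  mem _ ht := mem_image_of_mem _ ht

theorem IsTransitionFunction.semigroup_zero (hκ : IsTransitionFunction M K κ) (hx : x ∈ M)
    (f : State d → ℝ) : semigroup κ 0 f x = f x := by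
  rw [semigroup, (hκ.forward x hx).initial, integral_dirac]

theorem IsTransitionFunction.semigroup_sub_eq (hκ : IsTransitionFunction M K κ) (hM : IsOpen M)
    (hV : IsWeight M V) (hK : IsTemperedOp M V K) (hκV : ActsOnTempered M V κ)
    (hf : IsTempered M V f) (hx : x ∈ M) {t : ℝ} (ht : 0 ≤ t) :
    IntervalIntegrable (fun s => semigroup κ s (K f) x) volume 0 t ∧
      semigroup κ t f x - f x = ∫ s in (0 : ℝ)..t, semigroup κ s (K f) x := by
  obtain ⟨hint, heq⟩ := (hκ.isPerturbedFlow hx t).integral_eq_add_integral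
    ⟨hM, hV, hK, isEmptyElim, hκV.hasBoundedMoments hM hV hκ hx t⟩ hf (right_mem_Icc.2 ht)
  simp only [perturbedOp, Finset.univ_eq_empty, Finset.sum_empty, add_zero] at hint heq
  refine ⟨hint, ?_⟩
  rw [semigroup, heq, integral_dirac, add_sub_cancel_left]
  rfl

theorem abs_intervalIntegral_le_mul {g : ℝ → ℝ} {t B : ℝ} (ht : 0 ≤ t)
    (hg : ∀ s ∈ Icc 0 t, |g s| ≤ B) : |∫ s in (0 : ℝ)..t, g s| ≤ B * t := by
  simpa [abs_of_nonneg ht] using intervalIntegral.norm_integral_le_of_norm_le_const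
    (a := 0) (b := t) (f := g) fun s hs => hg s (Ioc_subset_Icc_self (uIoc_of_le ht ▸ hs))

theorem IsTransitionFunction.exists_abs_semigroup_sub_le (hκ : IsTransitionFunction M K κ)
    (hM : IsOpen M) (hV : IsWeight M V) (hK : IsTemperedOp M V K) (hκV : ActsOnTempered M V κ)
    (hS : IsTemperedFamily M V S) (T : ℝ) :
    ∃ (k : ℕ) (C : ℝ), 0 ≤ C ∧ ∀ f ∈ S, ∀ t ∈ Icc 0 T, ∀ x ∈ M,
      |semigroup κ t f x - f x| ≤ C * t * V x ^ k := by
  obtain ⟨k, C, hC, hb⟩ := hκV.exists_abs_semigroup_le hV.one_le (hK.image S hS) T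
  refine ⟨k, C, hC, fun f hf t ht x hx => ?_⟩
  rw [(hκ.semigroup_sub_eq hM hV hK hκV (hS.isTempered hf) hx ht.1).2, mul_right_comm]
  exact abs_intervalIntegral_le_mul ht.1 fun s hs =>
    hb _ (mem_image_of_mem _ hf) s ⟨hs.1, hs.2.trans ht.2⟩ x hx

theorem IsTransitionFunction.exists_abs_semigroup_sub_sub_le (hκ : IsTransitionFunction M K κ)
    (hM : IsOpen M) (hV : IsWeight M V) (hK : IsTemperedOp M V K) (hκV : ActsOnTempered M V κ)
    (hS : IsTemperedFamily M V S) (T : ℝ) :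
    ∃ (k : ℕ) (C : ℝ), 0 ≤ C ∧ ∀ f ∈ S, ∀ t ∈ Icc 0 T, ∀ x ∈ M,
      |semigroup κ t f x - f x - t * K f x| ≤ C * t ^ 2 * V x ^ k := by
  obtain ⟨k, C, hC, hb⟩ := hκ.exists_abs_semigroup_sub_le hM hV hK hκV (hK.image S hS) T
  refine ⟨k, C, hC, fun f hf t ht x hx => ?_⟩
  obtain ⟨hint, heq⟩ := hκ.semigroup_sub_eq hM hV hK hκV (hS.isTempered hf) hx ht.1
  have hconst : t * K f x = ∫ _ in (0 : ℝ)..t, K f x := by simp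
  have hVx := zero_le_one.trans (hV.one_le x hx)
  rw [heq, hconst, ← intervalIntegral.integral_sub hint intervalIntegrable_const]
  calc |∫ s in (0 : ℝ)..t, (semigroup κ s (K f) x - K f x)| ≤ C * t * V x ^ k * t :=
        abs_intervalIntegral_le_mul ht.1 fun s hs =>
          (hb _ (mem_image_of_mem _ hf) s ⟨hs.1, hs.2.trans ht.2⟩ x hx).trans <| by
            gcongr
            exact hs.2
    _ = C * t ^ 2 * V x ^ k := by ring

theorem IsTransitionFunction.semigroup_add (hκ : IsTransitionFunction M K κ)
    (hκV : ActsOnTempered M V κ) (hf : IsTempered M V f) {s t : ℝ} (hs : 0 ≤ s) (ht : 0 ≤ t)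
    (hx : x ∈ M) : semigroup κ (s + t) f x = semigroup κ s (semigroup κ t f) x := by
  have hint := hκV.integrable f hf (s + t) (add_nonneg hs ht) x hx
  rw [semigroup]
  rw [hκ.chapman s t hs ht x hx] at hint ⊢
  exact integral_bind_kernel hint

theorem integral_semigroup_of_invariant {ν : Measure (State d)} {t : ℝ}
    (hinv : Kernel.Invariant (κ t) ν) (hf : Integrable f ν) :
    ∫ x, semigroup κ t f x ∂ν = ∫ x, f x ∂ν := by
  rw [← hinv.def] at hf
  conv_rhs => rw [← hinv.def]
  exact (integral_bind_kernel hf).symm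

end Semigroup

section Telescoping

variable {Ψ m n : ℝ → ℝ} {a b : ℝ}

theorem abs_sub_le_integral_add_div_mul (hab : a ≤ b) (hm : IntervalIntegrable m volume a b)
    (hn : IntervalIntegrable n volume a b)
    (hlocal : ∀ s s', a ≤ s → s ≤ s' → s' ≤ b →
      |Ψ s' - Ψ s| ≤ (∫ r in s..s', m r) + (s' - s) * ∫ r in s..s', n r) {N : ℕ} (hN : N ≠ 0) :
    |Ψ b - Ψ a| ≤ (∫ r in a..b, m r) + (b - a) / N * ∫ r in a..b, n r := by
  set h := (b - a) / N with hh
  set p : ℕ → ℝ := fun j => a + j * h with hp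
  have hstep : ∀ j, p (j + 1) - p j = h := fun j => by simp only [hp]; push_cast; ring
  have hfirst : p 0 = a := by simp [hp]
  have hlast : p N = b := by simp only [hp, hh]; field_simp; ring
  have hnonneg : 0 ≤ h := div_nonneg (sub_nonneg.2 hab) N.cast_nonneg
  have hmono : Monotone p := monotone_nat_of_le_succ fun j => by linarith [hstep j]
  have hlower : ∀ j, a ≤ p j := fun j => hfirst ▸ hmono j.zero_le
  have hupper : ∀ j ≤ N, p j ≤ b := fun j hj => hlast ▸ hmono hj
  have hsum : ∀ {g : ℝ → ℝ}, IntervalIntegrable g volume a b →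
      ∑ j ∈ Finset.range N, ∫ r in p j..p (j + 1), g r = ∫ r in a..b, g r := fun hg => by
    rw [intervalIntegral.sum_integral_adjacent_intervals fun j hj =>
      intervalIntegrable_of_mem_Icc hg ⟨hlower j, hupper j hj.le⟩ ⟨hlower _, hupper _ hj⟩,
      hfirst, hlast]
  calc |Ψ b - Ψ a| = |∑ j ∈ Finset.range N, (Ψ (p (j + 1)) - Ψ (p j))| := by
        rw [Finset.sum_range_sub (fun j => Ψ (p j)), hfirst, hlast]
    _ ≤ ∑ j ∈ Finset.range N, |Ψ (p (j + 1)) - Ψ (p j)| := Finset.abs_sum_le_sum_abs _ _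
    _ ≤ ∑ j ∈ Finset.range N, ((∫ r in p j..p (j + 1), m r) + h * ∫ r in p j..p (j + 1), n r) := by
        refine Finset.sum_le_sum fun j hj => ?_
        have hj' := hlocal (p j) (p (j + 1)) (hlower j) (hmono j.le_succ)
          (hupper _ (Finset.mem_range.1 hj))
        rwa [hstep] at hj'
    _ = (∫ r in a..b, m r) + h * ∫ r in a..b, n r := by
        rw [Finset.sum_add_distrib, ← Finset.mul_sum, hsum hm, hsum hn]

theorem abs_sub_le_integral_of_local_le (hab : a ≤ b) (hm : IntervalIntegrable m volume a b)
    (hn : IntervalIntegrable n volume a b)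
    (hlocal : ∀ s s', a ≤ s → s ≤ s' → s' ≤ b →
      |Ψ s' - Ψ s| ≤ (∫ r in s..s', m r) + (s' - s) * ∫ r in s..s', n r) :
    |Ψ b - Ψ a| ≤ ∫ r in a..b, m r := by
  have hlim : Tendsto (fun N : ℕ => (∫ r in a..b, m r) + (b - a) / N * ∫ r in a..b, n r) atTop
      (𝓝 (∫ r in a..b, m r)) := by
    simpa using ((tendsto_const_div_atTop_nhds_zero_nat (b - a)).mul_const
      (∫ r in a..b, n r)).const_add (∫ r in a..b, m r)
  refine ge_of_tendsto hlim ?_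
  filter_upwards [eventually_ne_atTop 0] with N hN
  exact abs_sub_le_integral_add_div_mul hab hm hn hlocal hN

end Telescoping

section Duhamel

variable {d : ℕ} {M : Set (State d)} {V f : State d → ℝ} {ι : Type*}
  {K : (State d → ℝ) → State d → ℝ} {c : ι → ℝ → ℝ} {D : ι → (State d → ℝ) → State d → ℝ}
  {E : Set (Measure (State d))} {S : Set (State d → ℝ)} {T : ℝ}
  {μ₀ : Measure (State d)} {μ : ℝ → Measure (State d)} {κ : ℝ → Kernel (State d) (State d)}

theorem IsTemperedSystem.exists_abs_integral_semigroup_sub_sub_le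
    (h : IsTemperedSystem M V K D E) (hκ : IsTransitionFunction M K κ)
    (hκV : ActsOnTempered M V κ) (hS : IsTemperedFamily M V S) (T : ℝ) :
    ∃ B : ℝ, 0 ≤ B ∧ ∀ ν ∈ E, ∀ f ∈ S, ∀ t ∈ Icc 0 T,
      |∫ x, semigroup κ t f x ∂ν - ∫ x, f x ∂ν - t * ∫ x, K f x ∂ν| ≤ B * t ^ 2 := by
  obtain ⟨k, C, hC, hbound⟩ :=
    hκ.exists_abs_semigroup_sub_sub_le h.isOpen h.weight h.generator hκV hS T
  obtain ⟨B, hB, hmoment⟩ := h.moments.exists_abs_integral_le_mul k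
  refine ⟨C * B, mul_nonneg hC hB, fun ν hν f hf t ht => ?_⟩
  have hint := h.integrable hν (hS.isTempered hf)
  have hPint := h.integrable hν (hκV.isTempered_semigroup (hS.isTempered hf) ht.1)
  have hKint := h.integrable hν (h.generator.isTempered (hS.isTempered hf))
  have hsub : Integrable (fun x => semigroup κ t f x - f x) ν := hPint.sub hint
  rw [← integral_const_mul, ← integral_sub hPint hint, ← integral_sub hsub (hKint.const_mul t)]
  exact (hmoment ν hν _ _ (by positivity) (hbound f hf t ht)).trans_eq (by ring)

theorem IsTemperedSystem.integral_semigroup_semigroup (h : IsTemperedSystem M V K D E)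
    (hκ : IsTransitionFunction M K κ) (hκV : ActsOnTempered M V κ) (hf : IsTempered M V f)
    {ν : Measure (State d)} (hν : ν ∈ E) {s t : ℝ} (hs : 0 ≤ s) (ht : 0 ≤ t) :
    ∫ x, semigroup κ s (semigroup κ t f) x ∂ν = ∫ x, semigroup κ (s + t) f x ∂ν := by
  refine integral_congr_ae ?_
  filter_upwards [mem_ae_iff.2 (h.moments.measure_compl ν hν)] with x hx
  exact (hκ.semigroup_add hκV hf hs ht hx).symm

theorem IsTemperedSystem.integral_semigroup_zero (h : IsTemperedSystem M V K D E)
    (hκ : IsTransitionFunction M K κ) {ν : Measure (State d)} (hν : ν ∈ E) (f : State d → ℝ) :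
    ∫ x, semigroup κ 0 f x ∂ν = ∫ x, f x ∂ν := by
  refine integral_congr_ae ?_
  filter_upwards [mem_ae_iff.2 (h.moments.measure_compl ν hν)] with x hx
    using hκ.semigroup_zero hx f

variable [Fintype ι]

/-- The rate `∑ⱼ cⱼ(r) ∫ Dⱼ f dμ(r)` at which the perturbation changes the average of `f`. -/
noncomputable def perturbationRate (c : ι → ℝ → ℝ) (D : ι → (State d → ℝ) → State d → ℝ)
    (μ : ℝ → Measure (State d)) (f : State d → ℝ) (r : ℝ) : ℝ :=
  ∑ j, c j r * ∫ x, D j f x ∂(μ r)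

theorem IsPerturbedFlow.intervalIntegrable_integral (hμ : IsPerturbedFlow M K c D E T μ₀ μ)
    (h : IsTemperedSystem M V K D E) (hf : IsTempered M V f) {s t : ℝ} (hs : 0 ≤ s) (hst : s ≤ t)
    (ht : t ≤ T) : IntervalIntegrable (fun r => ∫ x, f x ∂(μ r)) volume s t :=
  ((hμ.continuousOn_integral h hf).mono (Icc_subset_Icc hs ht)).intervalIntegrable_of_Icc hst

theorem IsPerturbedFlow.intervalIntegrable_rate (hμ : IsPerturbedFlow M K c D E T μ₀ μ)
    (h : IsTemperedSystem M V K D E) (hf : IsTempered M V f) {s t : ℝ} (hs : 0 ≤ s) (hst : s ≤ t)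
    (ht : t ≤ T) : IntervalIntegrable (perturbationRate c D μ f) volume s t :=
  intervalIntegrable_sum_mul
    (fun j => intervalIntegrable_of_mem_Icc (hμ.intervalIntegrable j) ⟨hs, hst.trans ht⟩
      ⟨hs.trans hst, ht⟩)
    fun j => (hμ.continuousOn_integral h ((h.perturbation j).isTempered hf)).mono
      ((uIcc_of_le hst).trans_subset (Icc_subset_Icc hs ht))

theorem IsPerturbedFlow.integral_sub_integral_eq_add_rate (hμ : IsPerturbedFlow M K c D E T μ₀ μ)
    (h : IsTemperedSystem M V K D E) (hf : IsTempered M V f) {s t : ℝ} (hs : 0 ≤ s) (hst : s ≤ t)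
    (ht : t ≤ T) :
    ∫ x, f x ∂(μ t) - ∫ x, f x ∂(μ s)
      = (∫ r in s..t, ∫ x, K f x ∂(μ r)) + ∫ r in s..t, perturbationRate c D μ f r := by
  rw [hμ.integral_sub_integral_eq h hf ⟨hs, hst.trans ht⟩ ⟨hs.trans hst, ht⟩,
    ← intervalIntegral.integral_add
      (hμ.intervalIntegrable_integral h (h.generator.isTempered hf) hs hst ht)
      (hμ.intervalIntegrable_rate h hf hs hst ht)]
  refine intervalIntegral.integral_congr fun r hr => ?_
  rw [uIcc_of_le hst] at hr
  exact h.integral_perturbedOp (hμ.mem r ⟨hs.trans hr.1, hr.2.trans ht⟩) hf c r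

theorem IsTemperedSystem.exists_abs_integral_integral_sub_le (h : IsTemperedSystem M V K D E)
    (hS : IsTemperedFamily M V S) :
    ∃ B : ℝ, 0 ≤ B ∧ ∀ (c : ι → ℝ → ℝ) (T : ℝ) (μ₀ : Measure (State d))
      (μ : ℝ → Measure (State d)), IsPerturbedFlow M K c D E T μ₀ μ → ∀ f ∈ S, ∀ s t, 0 ≤ s →
        s ≤ t → t ≤ T →
          |(∫ r in s..t, ∫ x, f x ∂(μ r)) - (t - s) * ∫ x, f x ∂(μ s)|
            ≤ B * ((t - s) * (t - s + ∫ r in s..t, perturbationSize c r)) := by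
  obtain ⟨B, hB, hbound⟩ := h.exists_abs_integral_sub_integral_le hS
  refine ⟨B, hB, fun c T μ₀ μ hμ f hf s t hs hst ht => ?_⟩
  have hconst : (t - s) * ∫ x, f x ∂(μ s) = ∫ _ in s..t, ∫ x, f x ∂(μ s) := by simp
  have hle : ∀ r ∈ uIoc s t, ‖∫ x, f x ∂(μ r) - ∫ x, f x ∂(μ s)‖
      ≤ B * (t - s + ∫ r in s..t, perturbationSize c r) := fun r hr => by
    rw [uIoc_of_le hst] at hr
    refine (hbound c T μ₀ μ hμ f hf s r hs hr.1.le (hr.2.trans ht)).trans ?_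
    gcongr
    · exact hr.2
    · exact integral_perturbationSize_mono (hμ.intervalIntegrable_size hs hst ht) le_rfl hr.1.le
        hr.2
  rw [hconst, ← intervalIntegral.integral_sub
    (hμ.intervalIntegrable_integral h (hS.isTempered hf) hs hst ht) intervalIntegrable_const]
  calc _ ≤ B * (t - s + ∫ r in s..t, perturbationSize c r) * |t - s| :=
        intervalIntegral.norm_integral_le_of_norm_le_const hle
    _ = _ := by rw [abs_of_nonneg (sub_nonneg.2 hst)]; ring

theorem IsTemperedSystem.exists_abs_duhamel_le (h : IsTemperedSystem M V K D E)
    (hκ : IsTransitionFunction M K κ) (hκV : ActsOnTempered M V κ)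
    (hS : IsTemperedFamily M V S) (T : ℝ) :
    ∃ C : ℝ, 0 ≤ C ∧ ∀ (c : ι → ℝ → ℝ) (μ₀ : Measure (State d)) (μ : ℝ → Measure (State d)),
      IsPerturbedFlow M K c D E T μ₀ μ → ∀ f ∈ S, ∀ s t, 0 ≤ s → s ≤ t → t ≤ T →
        |∫ x, f x ∂(μ t) - ∫ x, semigroup κ (t - s) f x ∂(μ s)
            - ∫ r in s..t, perturbationRate c D μ f r|
          ≤ C * ((t - s) * (t - s + ∫ r in s..t, perturbationSize c r)) := by
  obtain ⟨B, hB, hflow⟩ := h.exists_abs_integral_integral_sub_le (h.generator.image S hS)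
  obtain ⟨B', hB', hsemigroup⟩ := h.exists_abs_integral_semigroup_sub_sub_le hκ hκV hS T
  refine ⟨B + B', add_nonneg hB hB', fun c μ₀ μ hμ f hf s t hs hst ht => ?_⟩
  have hflow' := hflow c T μ₀ μ hμ _ (mem_image_of_mem K hf) s t hs hst ht
  have hsemigroup' := hsemigroup _ (hμ.mem s ⟨hs, hst.trans ht⟩) f hf (t - s)
    ⟨sub_nonneg.2 hst, by linarith⟩
  have hlength : 0 ≤ t - s := sub_nonneg.2 hst
  have hsize : 0 ≤ B' * (t - s) * ∫ r in s..t, perturbationSize c r :=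
    mul_nonneg (mul_nonneg hB' hlength) (integral_perturbationSize_nonneg hst)
  have hdecomp := hμ.integral_sub_integral_eq_add_rate h (hS.isTempered hf) hs hst ht
  rw [abs_le] at hflow' hsemigroup' ⊢
  constructor <;> linarith

theorem IsPerturbedFlow.exists_abs_integral_semigroup_sub_le
    (hμ : IsPerturbedFlow M K c D E T μ₀ μ) (h : IsTemperedSystem M V K D E)
    (hκ : IsTransitionFunction M K κ) (hκV : ActsOnTempered M V κ) (hf : IsTempered M V f)
    {t : ℝ} (ht : t ≤ T) :
    ∃ C : ℝ, ∀ s s', 0 ≤ s → s ≤ s' → s' ≤ t →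
      |∫ x, semigroup κ (t - s') f x ∂(μ s') - ∫ x, semigroup κ (t - s) f x ∂(μ s)
          - ∫ r in s..s', perturbationRate c D μ (semigroup κ (t - s') f) r|
        ≤ (s' - s) * ∫ r in s..s', C * (1 + perturbationSize c r) := by
  obtain ⟨C, -, hduhamel⟩ := h.exists_abs_duhamel_le hκ hκV (hκV.bounded _ hf t) T
  refine ⟨C, fun s s' hs hss hst => ?_⟩
  have hsT : s ∈ Icc 0 T := ⟨hs, hss.trans (hst.trans ht)⟩
  have hshort := hduhamel c μ₀ μ hμ (semigroup κ (t - s') f)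
    ⟨f, rfl, t - s', ⟨sub_nonneg.2 hst, by linarith⟩, rfl⟩ s s' hs hss (hst.trans ht)
  rw [h.integral_semigroup_semigroup hκ hκV hf (hμ.mem s hsT) (sub_nonneg.2 hss)
    (sub_nonneg.2 hst), sub_add_sub_cancel'] at hshort
  rw [intervalIntegral.integral_const_mul, intervalIntegral.integral_add intervalIntegrable_const
    (hμ.intervalIntegrable_size hs hss (hst.trans ht)), intervalIntegral.integral_const,
    smul_eq_mul, mul_one]
  exact hshort.trans_eq (by ring)

/-- The integrand `perturbationRate c D μ (semigroup κ (t - r) f) r` of Duhamel's formula is not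
known to be measurable in `r`. It is therefore compared with an integrable function `R` while the
observable is frozen at the right end of a short interval. -/
theorem IsPerturbedFlow.abs_integral_sub_integral_semigroup_sub_le
    (hμ : IsPerturbedFlow M K c D E T μ₀ μ) (h : IsTemperedSystem M V K D E)
    (hκ : IsTransitionFunction M K κ) (hκV : ActsOnTempered M V κ) (hf : IsTempered M V f)
    {t : ℝ} (ht : t ∈ Icc 0 T) {R m n : ℝ → ℝ} (hR : IntervalIntegrable R volume 0 t)
    (hm : IntervalIntegrable m volume 0 t) (hn : IntervalIntegrable n volume 0 t)
    (hrate : ∀ s r s', 0 ≤ s → s ≤ r → r ≤ s' → s' ≤ t →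
      |perturbationRate c D μ (semigroup κ (t - s') f) r - R r| ≤ m r + (s' - s) * n r) :
    |∫ x, f x ∂(μ t) - ∫ x, semigroup κ t f x ∂μ₀ - ∫ r in (0 : ℝ)..t, R r|
      ≤ ∫ r in (0 : ℝ)..t, m r := by
  obtain ⟨C, hduhamel⟩ := hμ.exists_abs_integral_semigroup_sub_le h hκ hκV hf ht.2
  have hsize : IntervalIntegrable (fun r => C * (1 + perturbationSize c r)) volume 0 t :=
    (intervalIntegrable_const.add (hμ.intervalIntegrable_size le_rfl ht.1 ht.2)).const_mul C
  have htelescope := abs_sub_le_integral_of_local_le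
    (Ψ := fun s => ∫ x, semigroup κ (t - s) f x ∂(μ s) - ∫ r in (0 : ℝ)..s, R r) ht.1 hm
    (hsize.add hn) fun s s' hs hss hst => ?_
  · have h0 := h.integral_semigroup_zero hκ (hμ.mem t ht) f
    simp only [sub_self, sub_zero, intervalIntegral.integral_same, h0, hμ.solution.initial]
      at htelescope
    rwa [sub_right_comm]
  have hsub : ∀ {g : ℝ → ℝ}, IntervalIntegrable g volume 0 t → IntervalIntegrable g volume s s' :=
    fun hg => intervalIntegrable_of_mem_Icc hg ⟨hs, hss.trans hst⟩ ⟨hs.trans hss, hst⟩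
  have hcompare := abs_integral_sub_integral_le hss
    (hμ.intervalIntegrable_rate h (hκV.isTempered_semigroup hf (sub_nonneg.2 hst)) hs hss
      (hst.trans ht.2)) (hsub hR) ((hsub hm).add ((hsub hn).const_mul (s' - s)))
    fun r hr => hrate s r s' hs hr.1 hr.2 hst
  rw [intervalIntegral.integral_add (hsub hm) ((hsub hn).const_mul (s' - s)),
    intervalIntegral.integral_const_mul] at hcompare
  rw [intervalIntegral.integral_add (hsub hsize) (hsub hn)]
  have hRsub := intervalIntegral.integral_interval_sub_left
    (intervalIntegrable_of_mem_Icc hR (left_mem_Icc.2 ht.1) ⟨hs.trans hss, hst⟩)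
    (intervalIntegrable_of_mem_Icc hR (left_mem_Icc.2 ht.1) ⟨hs, hss.trans hst⟩)
  have hshort := hduhamel s s' hs hss hst
  rw [abs_le] at hshort hcompare ⊢
  constructor <;> linarith

end Duhamel

section LinearResponse

variable {d : ℕ} {M : Set (State d)} {V f : State d → ℝ} {ι : Type*} [Fintype ι]
  {K : (State d → ℝ) → State d → ℝ} {c : ι → ℝ → ℝ} {D : ι → (State d → ℝ) → State d → ℝ}
  {E : Set (Measure (State d))} {S : Set (State d → ℝ)} {T : ℝ}
  {π : Measure (State d)} {μ : ℝ → Measure (State d)} {κ : ℝ → Kernel (State d) (State d)}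

theorem IsTemperedSystem.exists_abs_integral_sub_integral_semigroup_le
    (h : IsTemperedSystem M V K D E) (hκ : IsTransitionFunction M K κ)
    (hκV : ActsOnTempered M V κ) (hS : IsTemperedFamily M V S) (T : ℝ) :
    ∃ B : ℝ, 0 ≤ B ∧ ∀ (c : ι → ℝ → ℝ) (μ₀ : Measure (State d)) (μ : ℝ → Measure (State d)),
      IsPerturbedFlow M K c D E T μ₀ μ → ∀ f ∈ S, ∀ t ∈ Icc 0 T,
        |∫ x, f x ∂(μ t) - ∫ x, semigroup κ t f x ∂μ₀|
          ≤ B * ∫ r in (0 : ℝ)..T, perturbationSize c r := by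
  obtain ⟨B, hB, hbound⟩ := h.moments.exists_abs_integral_le h.weight.one_le
    (h.isTemperedFamily_perturbation (hκV.bounded S hS T))
  refine ⟨B, hB, fun c μ₀ μ hμ f hf t ht => ?_⟩
  have hsize := hμ.intervalIntegrable_size le_rfl ht.1 ht.2
  have hresponse := hμ.abs_integral_sub_integral_semigroup_sub_le h hκ hκV (hS.isTempered hf) ht
    (R := 0) (n := 0) intervalIntegrable_const (hsize.const_mul B) intervalIntegrable_const
    fun s r s' hs hsr hrs hst => by
      rw [Pi.zero_apply, sub_zero, mul_zero, add_zero]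
      exact abs_sum_mul_le (fun j => hbound _ (hμ.mem r ⟨hs.trans hsr, by linarith [ht.2]⟩) _ <|
        mem_iUnion_of_mem j <| mem_image_of_mem (D j)
          ⟨f, hf, t - s', ⟨sub_nonneg.2 hst, by linarith [ht.2]⟩, rfl⟩) c r
  simp only [Pi.zero_apply, intervalIntegral.integral_zero, sub_zero,
    intervalIntegral.integral_const_mul] at hresponse
  exact hresponse.trans (mul_le_mul_of_nonneg_left (integral_perturbationSize_mono
    (hμ.intervalIntegrable_size le_rfl (ht.1.trans ht.2) le_rfl) le_rfl ht.1 ht.2) hB)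

theorem IsTemperedSystem.exists_abs_integral_sub_integral_invariant_le
    (h : IsTemperedSystem M V K D E) (hκ : IsTransitionFunction M K κ)
    (hκV : ActsOnTempered M V κ) (hπ : ∀ t, 0 ≤ t → Kernel.Invariant (κ t) π)
    (hS : IsTemperedFamily M V S) (T : ℝ) :
    ∃ B : ℝ, 0 ≤ B ∧ ∀ (c : ι → ℝ → ℝ) (μ : ℝ → Measure (State d)),
      IsPerturbedFlow M K c D E T π μ → ∀ f ∈ S, ∀ t ∈ Icc 0 T,
        |∫ x, f x ∂(μ t) - ∫ x, f x ∂π| ≤ B * ∫ r in (0 : ℝ)..T, perturbationSize c r := by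
  obtain ⟨B, hB, hbound⟩ := h.exists_abs_integral_sub_integral_semigroup_le hκ hκV hS T
  refine ⟨B, hB, fun c μ hμ f hf t ht => ?_⟩
  have hπE : π ∈ E := hμ.solution.initial ▸ hμ.mem 0 ⟨le_rfl, ht.1.trans ht.2⟩
  rw [← integral_semigroup_of_invariant (hπ t ht.1) (h.integrable hπE (hS.isTempered hf))]
  exact hbound c π μ hμ f hf t ht

theorem IsTemperedSystem.exists_abs_linearResponse_le
    (h : IsTemperedSystem M V K D E) (hκ : IsTransitionFunction M K κ)
    (hκV : ActsOnTempered M V κ) (hπ : ∀ t, 0 ≤ t → Kernel.Invariant (κ t) π)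
    (hf : IsTempered M V f) {T : ℝ} {L : NNReal}
    (hL : ∀ j, LipschitzOnWith L (fun q => ∫ x, D j (semigroup κ q f) x ∂π) (Icc 0 T)) :
    ∃ C : ℝ, ∀ (c : ι → ℝ → ℝ) (μ : ℝ → Measure (State d)),
      IsPerturbedFlow M K c D E T π μ → ∀ t ∈ Icc 0 T,
        |∫ x, f x ∂(μ t) - ∫ x, semigroup κ t f x ∂π
            - ∫ r in (0 : ℝ)..t, ∑ j, c j r * ∫ x, D j (semigroup κ (t - r) f) x ∂π|
          ≤ C * (∫ r in (0 : ℝ)..T, perturbationSize c r) ^ 2 := by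
  obtain ⟨B, hB, hbound⟩ := h.exists_abs_integral_sub_integral_invariant_le hκ hκV hπ
    (h.isTemperedFamily_perturbation (hκV.bounded _ hf T)) T
  refine ⟨B, fun c μ hμ t ht => ?_⟩
  set A := ∫ r in (0 : ℝ)..T, perturbationSize c r
  have hT := ht.1.trans ht.2
  have hsizeT := hμ.intervalIntegrable_size le_rfl hT le_rfl
  have hsize := hμ.intervalIntegrable_size le_rfl ht.1 ht.2
  have hresponse := hμ.abs_integral_sub_integral_semigroup_sub_le h hκ hκV hf ht
    (R := fun r => ∑ j, c j r * ∫ x, D j (semigroup κ (t - r) f) x ∂π)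
    (intervalIntegrable_sum_mul
      (fun j => intervalIntegrable_of_mem_Icc (hμ.intervalIntegrable j) ⟨le_rfl, hT⟩ ht)
      fun j => (hL j).continuousOn.comp (by fun_prop) fun r hr => ?_)
    (hsize.const_mul (B * A)) (hsize.const_mul L) fun s r s' hs hsr hrs hst => ?_
  · rw [intervalIntegral.integral_const_mul] at hresponse
    refine hresponse.trans ?_
    rw [pow_two, ← mul_assoc]
    exact mul_le_mul_of_nonneg_left (integral_perturbationSize_mono hsizeT le_rfl ht.1 ht.2)
      (mul_nonneg hB (integral_perturbationSize_nonneg hT))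
  · rw [uIcc_of_le ht.1] at hr
    exact ⟨sub_nonneg.2 hr.2, by linarith [hr.1, ht.2]⟩
  · have hq : t - s' ∈ Icc 0 T := ⟨sub_nonneg.2 hst, by linarith [ht.2]⟩
    have hq' : t - r ∈ Icc 0 T := ⟨by linarith, by linarith [ht.2]⟩
    have hr : r ∈ Icc 0 T := ⟨hs.trans hsr, by linarith [ht.2]⟩
    have hfrozen : ∀ j, |∫ x, D j (semigroup κ (t - s') f) x ∂(μ r)
        - ∫ x, D j (semigroup κ (t - s') f) x ∂π| ≤ B * A := fun j =>
      hbound c μ hμ _ (mem_iUnion_of_mem j (mem_image_of_mem _ ⟨f, rfl, _, hq, rfl⟩)) r hr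
    have hlip : ∀ j, |∫ x, D j (semigroup κ (t - s') f) x ∂π
        - ∫ x, D j (semigroup κ (t - r) f) x ∂π| ≤ L * (s' - s) := fun j => by
      refine ((hL j).dist_le_mul _ hq _ hq').trans (mul_le_mul_of_nonneg_left ?_ L.2)
      rw [Real.dist_eq, abs_le]
      constructor <;> linarith
    rw [perturbationRate, ← Finset.sum_sub_distrib]
    simp only [← mul_sub]
    refine (abs_sum_mul_le (B := B * A + L * (s' - s)) (fun j => ?_) c r).trans_eq (by ring)
    exact (abs_sub_le _ _ _).trans (add_le_add (hfrozen j) (hlip j))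

end LinearResponse

section IntegrationByParts

variable {d : ℕ} {M : Set (State d)} {V a b f g : State d → ℝ} {n : ℕ}

theorem integrable_mul_of_tsupport_subset (hg : ContinuousOn g M) (hf : Continuous f)
    (hfc : HasCompactSupport f) (hfM : tsupport f ⊆ M) : Integrable fun x => f x * g x :=
  (integrableOn_iff_integrable_of_support_subset
    ((Function.support_mul_subset_left f g).trans (subset_tsupport f))).1
    ((hf.continuousOn.mul (hg.mono hfM)).integrableOn_compact hfc)

theorem tsupport_pderiv_subset (i : Fin d) (f : State d → ℝ) :
    tsupport (pderiv i f) ⊆ tsupport f :=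
  closure_minimal (fun x hx => by_contra fun hxf => hx <| by
    rw [pderiv, fderiv_of_notMem_tsupport ℝ hxf, zero_apply])
    (isClosed_tsupport f)

theorem setIntegral_pderiv_mul_of_hasCompactSupport (hM : IsOpen M) (ha : ContDiffOn ℝ ∞ a M)
    (hf : ContDiff ℝ ∞ f) (hfc : HasCompactSupport f) (hfM : tsupport f ⊆ M) (i : Fin d) :
    ∫ x in M, pderiv i f x * a x = -∫ x in M, f x * pderiv i a x := by
  have hdf : ContDiff ℝ ∞ (pderiv i f) :=
    contDiffOn_univ.1 (contDiffOn_pderiv isOpen_univ hf.contDiffOn i)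
  have hdfM := (tsupport_pderiv_subset i f).trans hfM
  have hda := contDiffOn_pderiv hM ha i
  rw [setIntegral_eq_integral_of_forall_compl_eq_zero fun x hx => by
      rw [image_eq_zero_of_notMem_tsupport fun h => hx (hdfM h), zero_mul],
    setIntegral_eq_integral_of_forall_compl_eq_zero fun x hx => by
      rw [image_eq_zero_of_notMem_tsupport fun h => hx (hfM h), zero_mul], eq_neg_iff_add_eq_zero,
    add_comm, ← eq_neg_iff_add_eq_zero]
  exact integral_mul_fderiv_eq_neg_fderiv_mul_of_integrable
    (integrable_mul_of_tsupport_subset ha.continuousOn hdf.continuous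
      (hfc.mono' ((subset_tsupport _).trans (tsupport_pderiv_subset i f))) hdfM)
    (integrable_mul_of_tsupport_subset hda.continuousOn hf.continuous hfc hfM)
    (integrable_mul_of_tsupport_subset ha.continuousOn hf.continuous hfc hfM)
    (fun x _ => hf.differentiable (by simp) x)
    (fun x hx => (ha.contDiffAt (hM.mem_nhds (hfM hx))).differentiableAt (by simp))

/-- Smooth functions on `M` whose derivatives up to order `n` are integrable against every power
of the weight, so that integration by parts against tempered functions has no boundary terms. -/
structure IsRapidlyDecreasing (M : Set (State d)) (V : State d → ℝ) (n : ℕ) (a : State d → ℝ) :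
    Prop where
  smooth : ContDiffOn ℝ ∞ a M
  integrable : ∀ k : ℕ, ∀ j ≤ n, IntegrableOn (fun x => V x ^ k * ‖iteratedFDeriv ℝ j a x‖) M

theorem integrableOn_pow_mul_norm_iteratedFDeriv (hM : IsOpen M) (hV : IsWeight M V)
    (ha : ContDiffOn ℝ ∞ a M) {B : State d → ℝ} (hB : IntegrableOn B M) {k : ℕ}
    (h : ∀ x ∈ M, V x ^ k * ‖iteratedFDeriv ℝ n a x‖ ≤ B x) :
    IntegrableOn (fun x => V x ^ k * ‖iteratedFDeriv ℝ n a x‖) M := by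
  have hcont : ContinuousOn (iteratedFDeriv ℝ n a) M :=
    (ha.continuousOn_iteratedFDerivWithin (by exact_mod_cast le_top) hM.uniqueDiffOn).congr
      fun x hx => (iteratedFDerivWithin_of_isOpen n hM hx).symm
  refine hB.mono' (((hV.tempered.contDiffOn.continuousOn.pow k).mul
    hcont.norm).aestronglyMeasurable hM.measurableSet) ?_
  filter_upwards [ae_restrict_mem hM.measurableSet] with x hx
  have := hV.one_le x hx
  rw [Real.norm_of_nonneg (by positivity)]
  exact h x hx

theorem IsRapidlyDecreasing.of_le {m : ℕ} (ha : IsRapidlyDecreasing M V n a) (hmn : m ≤ n) :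
    IsRapidlyDecreasing M V m a :=
  ⟨ha.smooth, fun k j hj => ha.integrable k j (hj.trans hmn)⟩

theorem IsRapidlyDecreasing.congr (hM : IsOpen M) (ha : IsRapidlyDecreasing M V n a)
    (hab : EqOn b a M) : IsRapidlyDecreasing M V n b :=
  ⟨ha.smooth.congr hab, fun k j hj => (ha.integrable k j hj).congr_fun (fun x hx => by
    rw [((hab.eventuallyEq_of_mem (hM.mem_nhds hx)).iteratedFDeriv ℝ j).eq_of_nhds])
    hM.measurableSet⟩

theorem IsRapidlyDecreasing.mul (hM : IsOpen M) (hV : IsWeight M V) (hf : IsTempered M V f)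
    (ha : IsRapidlyDecreasing M V n a) : IsRapidlyDecreasing M V n (f * a) := by
  refine ⟨hf.contDiffOn.mul ha.smooth, fun k j hj => ?_⟩
  obtain ⟨l, C, -, hb⟩ := hf.exists_bound_of_le hV.one_le n
  refine integrableOn_pow_mul_norm_iteratedFDeriv hM hV (hf.contDiffOn.mul ha.smooth)
    (integrable_finsetSum (Finset.range (j + 1)) fun i _ =>
      (ha.integrable (k + l) (j - i) ((Nat.sub_le j i).trans hj)).const_mul (j.choose i * C))
    fun x hx => ?_
  have := hV.one_le x hx
  have hleibniz := norm_iteratedFDeriv_mul_le_of_isOpen hM hf.contDiffOn ha.smooth hx j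
  refine (mul_le_mul_of_nonneg_left hleibniz (by positivity)).trans ?_
  rw [Finset.mul_sum]
  refine Finset.sum_le_sum fun i hi => ?_
  have hfi := hb i ((Finset.mem_range_succ_iff.1 hi).trans hj) f rfl x hx
  calc V x ^ k * (j.choose i * ‖iteratedFDeriv ℝ i f x‖ * ‖iteratedFDeriv ℝ (j - i) a x‖)
      ≤ V x ^ k * (j.choose i * (C * V x ^ l) * ‖iteratedFDeriv ℝ (j - i) a x‖) := by gcongr
    _ = j.choose i * C * (V x ^ (k + l) * ‖iteratedFDeriv ℝ (j - i) a x‖) := by ring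

theorem isRapidlyDecreasing_pderiv (hM : IsOpen M) (hV : IsWeight M V)
    (ha : IsRapidlyDecreasing M V (n + 1) a) (i : Fin d) :
    IsRapidlyDecreasing M V n (pderiv i a) := by
  refine ⟨contDiffOn_pderiv hM ha.smooth i, fun k j hj =>
    integrableOn_pow_mul_norm_iteratedFDeriv hM hV (contDiffOn_pderiv hM ha.smooth i)
      (ha.integrable k (j + 1) (Nat.succ_le_succ hj)) fun x hx => ?_⟩
  have := hV.one_le x hx
  gcongr
  exact norm_iteratedFDeriv_pderiv_le hM ha.smooth i j hx

theorem IsRapidlyDecreasing.integrableOn_pow_mul_abs (ha : IsRapidlyDecreasing M V n a) (k : ℕ) :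
    IntegrableOn (fun x => V x ^ k * |a x|) M := by
  simpa only [norm_iteratedFDeriv_zero, Real.norm_eq_abs] using ha.integrable k 0 n.zero_le

theorem IsRapidlyDecreasing.integrableOn_mul (hM : IsOpen M) (hV : IsWeight M V)
    (ha : IsRapidlyDecreasing M V n a) (hf : IsTempered M V f) :
    IntegrableOn (fun x => f x * a x) M := by
  obtain ⟨k, C, -, hb⟩ := hf.exists_abs_le hV.one_le
  refine ((ha.integrableOn_pow_mul_abs k).const_mul C).mono'
    ((hf.contDiffOn.mul ha.smooth).continuousOn.aestronglyMeasurable hM.measurableSet) ?_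
  filter_upwards [ae_restrict_mem hM.measurableSet] with x hx
  rw [Real.norm_eq_abs, abs_mul, ← mul_assoc]
  exact mul_le_mul_of_nonneg_right (hb x hx) (abs_nonneg _)

theorem IsRapidlyDecreasing.tendsto_setIntegral_truncate (hM : IsOpen M) (hV : IsWeight M V)
    (ha : IsRapidlyDecreasing M V n a) {D : (State d → ℝ) → State d → ℝ}
    (hD : IsTemperedOp M V D) (hf : IsTempered M V f) :
    Tendsto (fun N => ∫ x in M, D (truncate M V f N) x * a x) atTop
      (𝓝 (∫ x in M, D f x * a x)) := by
  have htrunc := hD.image _ (isTemperedFamily_truncate hM hV hf)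
  obtain ⟨k, C, -, hb⟩ := htrunc.exists_abs_le hV.one_le
  refine tendsto_integral_of_dominated_convergence (fun x => C * (V x ^ k * |a x|)) (fun N => ?_)
    ((ha.integrableOn_pow_mul_abs k).const_mul C) (fun N => ?_) ?_
  · exact ((htrunc.1 _ (mem_image_of_mem D (mem_range_self N))).mul
      ha.smooth).continuousOn.aestronglyMeasurable hM.measurableSet
  · filter_upwards [ae_restrict_mem hM.measurableSet] with x hx
    rw [Real.norm_eq_abs, abs_mul, ← mul_assoc]
    exact mul_le_mul_of_nonneg_right (hb _ (mem_image_of_mem D (mem_range_self N)) x hx)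
      (abs_nonneg _)
  · filter_upwards [ae_restrict_mem hM.measurableSet] with x hx
    exact tendsto_const_nhds.congr' ((hD.eventually_truncate_eq hM hV f hx).mono fun N hN => by
      simp only [hN])

theorem IsRapidlyDecreasing.setIntegral_pderiv_mul (hM : IsOpen M) (hV : IsWeight M V)
    (ha : IsRapidlyDecreasing M V (n + 1) a) (hf : IsTempered M V f) (i : Fin d) :
    ∫ x in M, pderiv i f x * a x = -∫ x in M, f x * pderiv i a x :=
  have hderiv := isRapidlyDecreasing_pderiv hM hV ha i
  tendsto_nhds_unique (ha.tendsto_setIntegral_truncate hM hV (isTemperedOp_pderiv hM i) hf) <|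
    (hderiv.tendsto_setIntegral_truncate hM hV isTemperedOp_id hf).neg.congr fun N =>
      (setIntegral_pderiv_mul_of_hasCompactSupport hM ha.smooth (contDiff_truncate hM hV hf N)
        (hasCompactSupport_truncate hV f N) (tsupport_truncate_subset hV f N) i).symm

theorem IsRapidlyDecreasing.setIntegral_driftOp_mul (hM : IsOpen M) (hV : IsWeight M V)
    (ha : IsRapidlyDecreasing M V (n + 1) a) (hb : IsTempered M V b) (hf : IsTempered M V f)
    (i : Fin d) :
    ∫ x in M, driftOp b i f x * a x = -∫ x in M, f x * pderiv i (b * a) x := by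
  rw [← (ha.mul hM hV hb).setIntegral_pderiv_mul hM hV hf i]
  simp only [driftOp, Pi.mul_apply, mul_left_comm, mul_assoc]

theorem IsRapidlyDecreasing.setIntegral_diffusionOp_mul (hM : IsOpen M) (hV : IsWeight M V)
    (ha : IsRapidlyDecreasing M V (n + 2) a) (hb : IsTempered M V b) (hf : IsTempered M V f)
    (i : Fin d) :
    ∫ x in M, diffusionOp b i f x * a x
      = ∫ x in M, f x * pderiv i (pderiv i (b * a)) x := by
  have hba := ha.mul hM hV hb
  calc ∫ x in M, diffusionOp b i f x * a x
      = ∫ x in M, pderiv i (pderiv i f) x * (b * a) x := by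
        simp only [diffusionOp, Pi.mul_apply, mul_left_comm, mul_assoc]
    _ = -∫ x in M, pderiv i f x * pderiv i (b * a) x :=
        hba.setIntegral_pderiv_mul hM hV ((isTemperedOp_pderiv hM i).isTempered hf) i
    _ = ∫ x in M, f x * pderiv i (pderiv i (b * a)) x := by
        rw [(isRapidlyDecreasing_pderiv hM hV hba i).setIntegral_pderiv_mul hM hV hf i, neg_neg]

theorem IsTransitionFunction.exists_lipschitzOnWith_setIntegral_semigroup_mul
    {K : (State d → ℝ) → State d → ℝ} {κ : ℝ → Kernel (State d) (State d)}
    (hκ : IsTransitionFunction M K κ) (hM : IsOpen M) (hV : IsWeight M V)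
    (hK : IsTemperedOp M V K) (hκV : ActsOnTempered M V κ) (ha : IsRapidlyDecreasing M V n a)
    (hf : IsTempered M V f) (T : ℝ) :
    ∃ L : NNReal,
      LipschitzOnWith L (fun q => ∫ x in M, semigroup κ q f x * a x) (Icc 0 T) := by
  obtain ⟨k, C, -, hb⟩ := hκ.exists_abs_semigroup_sub_le hM hV hK hκV (hκV.bounded _ hf T) T
  refine ⟨(C * ∫ x in M, V x ^ k * |a x|).toNNReal, LipschitzOnWith.of_dist_le_mul ?_⟩
  intro p hp q hq
  wlog hpq : p ≤ q generalizing p q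
  · simpa only [dist_comm] using this q hq p hp (le_of_not_ge hpq)
  have hint : ∀ t ∈ Icc 0 T, IntegrableOn (fun x => semigroup κ t f x * a x) M := fun t ht =>
    ha.integrableOn_mul hM hV (hκV.isTempered_semigroup hf ht.1)
  rw [dist_comm, Real.dist_eq, ← integral_sub (hint q hq) (hint p hp), dist_comm, Real.dist_eq,
    abs_of_nonneg (sub_nonneg.2 hpq)]
  calc |∫ x in M, (semigroup κ q f x * a x - semigroup κ p f x * a x)|
      ≤ ∫ x in M, C * (q - p) * (V x ^ k * |a x|) := by
        refine norm_integral_le_of_norm_le (G := ℝ) ((ha.integrableOn_pow_mul_abs k).const_mul _) ?_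
        filter_upwards [ae_restrict_mem hM.measurableSet] with x hx
        have hincrement := hb _ ⟨f, rfl, p, hp, rfl⟩ (q - p)
          ⟨sub_nonneg.2 hpq, by linarith [hp.1, hq.2]⟩ x hx
        rw [← hκ.semigroup_add hκV hf (sub_nonneg.2 hpq) hp.1 hx, sub_add_cancel] at hincrement
        rw [← sub_mul, Real.norm_eq_abs, abs_mul, ← mul_assoc]
        exact mul_le_mul_of_nonneg_right hincrement (abs_nonneg _)
    _ = C * (∫ x in M, V x ^ k * |a x|) * (q - p) := by rw [integral_const_mul]; ring
    _ ≤ (C * ∫ x in M, V x ^ k * |a x|).toNNReal * (q - p) :=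
        mul_le_mul_of_nonneg_right (Real.le_coe_toNNReal _) (sub_nonneg.2 hpq)

end IntegrationByParts

section SteadyState

variable {d : ℕ} {M : Set (State d)} {V ρ f g r : State d → ℝ} {n : ℕ}
  {D : (State d → ℝ) → State d → ℝ} {K : (State d → ℝ) → State d → ℝ}
  {κ : ℝ → Kernel (State d) (State d)}

theorem integral_densityMeasure (hM : IsOpen M) (hρ : ContinuousOn ρ M) (hpos : ∀ x ∈ M, 0 < ρ x)
    (f : State d → ℝ) : ∫ x, f x ∂(densityMeasure M ρ) = steadyAverage M ρ f := by
  rw [densityMeasure, integral_withDensity_eq_integral_toReal_smul₀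
    (hρ.aemeasurable hM.measurableSet).ennreal_ofReal (ae_of_all _ fun _ => ENNReal.ofReal_lt_top)]
  refine setIntegral_congr_fun hM.measurableSet fun x hx => ?_
  simp only [ENNReal.toReal_ofReal (hpos x hx).le, smul_eq_mul, mul_comm]

theorem pderiv_mul {x : State d} (i : Fin d) (hf : DifferentiableAt ℝ f x)
    (hg : DifferentiableAt ℝ g x) :
    pderiv i (f * g) x = pderiv i f x * g x + f x * pderiv i g x := by
  simp only [pderiv, fderiv_mul hf hg, add_apply, smul_apply, smul_eq_mul]
  ring

theorem pderiv_pderiv_mul (hM : IsOpen M) (hf : ContDiffOn ℝ ∞ f M) (hg : ContDiffOn ℝ ∞ g M)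
    {x : State d} (hx : x ∈ M) (i : Fin d) :
    pderiv i (pderiv i (f * g)) x
      = pderiv i (pderiv i f) x * g x + 2 * (pderiv i f x * pderiv i g x)
        + f x * pderiv i (pderiv i g) x := by
  have hdiff : ∀ {w : State d → ℝ}, ContDiffOn ℝ ∞ w M → ∀ y ∈ M, DifferentiableAt ℝ w y :=
    fun hw y hy => (hw.contDiffAt (hM.mem_nhds hy)).differentiableAt (by simp)
  have hf' := contDiffOn_pderiv hM hf i
  have hg' := contDiffOn_pderiv hM hg i
  have hfirst : pderiv i (f * g) =ᶠ[𝓝 x] pderiv i f * g + f * pderiv i g := by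
    filter_upwards [hM.mem_nhds hx] with y hy using pderiv_mul i (hdiff hf y hy) (hdiff hg y hy)
  calc pderiv i (pderiv i (f * g)) x
      = pderiv i (pderiv i f * g) x + pderiv i (f * pderiv i g) x := by
        rw [pderiv, hfirst.fderiv_eq, fderiv_add (f := pderiv i f * g) (g := f * pderiv i g)
          (hdiff (hf'.mul hg) x hx) (hdiff (hf.mul hg') x hx)]
        rfl
    _ = _ := by
        rw [pderiv_mul i (hdiff hf' x hx) (hdiff hg x hx),
          pderiv_mul i (hdiff hf x hx) (hdiff hg' x hx)]
        ring

theorem driftResponse_mul (F' : Fin d → State d → ℝ) (i : Fin d) {x : State d} (hx : ρ x ≠ 0) :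
    driftResponse ρ F' i x * ρ x = pderiv i (F' i * ρ) x := by
  rw [driftResponse, mul_right_comm, one_div_mul_cancel hx, one_mul]
  rfl

theorem noiseResponse_mul (hM : IsOpen M) (hρ : ContDiffOn ℝ ∞ ρ M) {σ' : Fin d → State d → ℝ}
    {i : Fin d} (hσ' : ContDiffOn ℝ ∞ (σ' i) M) {x : State d} (hxM : x ∈ M) (hx : ρ x ≠ 0) :
    noiseResponse ρ σ' i x * ρ x = pderiv i (pderiv i ((fun y => σ' i y ^ 2) * ρ)) x := by
  rw [pderiv_pderiv_mul hM (hσ'.pow 2) hρ hxM, noiseResponse]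
  field_simp

theorem isRapidlyDecreasing_driftResponse_mul (hM : IsOpen M) (hV : IsWeight M V)
    (hρ : IsRapidlyDecreasing M V (n + 1) ρ) (hpos : ∀ x ∈ M, ρ x ≠ 0) {F' : Fin d → State d → ℝ}
    {i : Fin d} (hF' : IsTempered M V (F' i)) :
    IsRapidlyDecreasing M V n (driftResponse ρ F' i * ρ) :=
  (isRapidlyDecreasing_pderiv hM hV (hρ.mul hM hV hF') i).congr hM fun x hx =>
    driftResponse_mul F' i (hpos x hx)

theorem isRapidlyDecreasing_noiseResponse_mul (hM : IsOpen M) (hV : IsWeight M V)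
    (hρ : IsRapidlyDecreasing M V (n + 2) ρ) (hpos : ∀ x ∈ M, ρ x ≠ 0) {σ' : Fin d → State d → ℝ}
    {i : Fin d} (hσ' : IsTempered M V (σ' i)) :
    IsRapidlyDecreasing M V n (noiseResponse ρ σ' i * ρ) :=
  (isRapidlyDecreasing_pderiv hM hV (isRapidlyDecreasing_pderiv hM hV
    (hρ.mul hM hV (hσ'.pow hM hV.one_le 2)) i) i).congr hM fun x hx =>
      noiseResponse_mul hM hρ.smooth hσ'.contDiffOn hx (hpos x hx)

theorem steadyAverage_mul (r f : State d → ℝ) :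
    steadyAverage M ρ (fun x => r x * f x) = ∫ x in M, f x * (r * ρ) x := by
  simp only [steadyAverage, Pi.mul_apply, mul_left_comm, mul_assoc]

theorem steadyAverage_driftOp (hM : IsOpen M) (hV : IsWeight M V)
    (hρ : IsRapidlyDecreasing M V (n + 1) ρ) (hpos : ∀ x ∈ M, ρ x ≠ 0) {F' : Fin d → State d → ℝ}
    {i : Fin d} (hF' : IsTempered M V (F' i)) (hf : IsTempered M V f) :
    steadyAverage M ρ (driftOp (F' i) i f)
      = -steadyAverage M ρ fun x => driftResponse ρ F' i x * f x := by
  rw [steadyAverage, hρ.setIntegral_driftOp_mul hM hV hF' hf, steadyAverage_mul]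
  exact congrArg _ <| setIntegral_congr_fun hM.measurableSet fun x hx =>
    congrArg (f x * ·) (driftResponse_mul F' i (hpos x hx)).symm

theorem steadyAverage_diffusionOp (hM : IsOpen M) (hV : IsWeight M V)
    (hρ : IsRapidlyDecreasing M V (n + 2) ρ) (hpos : ∀ x ∈ M, ρ x ≠ 0) {σ' : Fin d → State d → ℝ}
    {i : Fin d} (hσ' : IsTempered M V (σ' i)) (hf : IsTempered M V f) :
    steadyAverage M ρ (diffusionOp (fun x => σ' i x ^ 2) i f)
      = steadyAverage M ρ fun x => noiseResponse ρ σ' i x * f x := by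
  rw [steadyAverage, hρ.setIntegral_diffusionOp_mul hM hV (hσ'.pow hM hV.one_le 2) hf,
    steadyAverage_mul]
  exact setIntegral_congr_fun hM.measurableSet fun x hx =>
    congrArg (f x * ·) (noiseResponse_mul hM hρ.smooth hσ'.contDiffOn hx (hpos x hx)).symm

theorem IsRapidlyDecreasing.integrableOn_mul_mul (hr : IsRapidlyDecreasing M V n (r * ρ))
    (hM : IsOpen M) (hV : IsWeight M V) (hf : IsTempered M V f) :
    IntegrableOn (fun x => r x * f x * ρ x) M := by
  simpa only [Pi.mul_apply, mul_left_comm, mul_assoc] using hr.integrableOn_mul hM hV hf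

theorem IsTransitionFunction.exists_lipschitzOnWith_steadyAverage
    (hκ : IsTransitionFunction M K κ) (hM : IsOpen M) (hV : IsWeight M V)
    (hK : IsTemperedOp M V K) (hκV : ActsOnTempered M V κ)
    (hr : IsRapidlyDecreasing M V n (r * ρ)) (hf : IsTempered M V f) (T : ℝ) :
    ∃ L : NNReal, LipschitzOnWith L
      (fun q => steadyAverage M ρ fun x => r x * semigroup κ q f x) (Icc 0 T) := by
  simp only [steadyAverage_mul]
  exact hκ.exists_lipschitzOnWith_setIntegral_semigroup_mul hM hV hK hκV hr hf T

theorem IsTransitionFunction.intervalIntegrable_steadyAverage_mul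
    (hκ : IsTransitionFunction M K κ) (hM : IsOpen M) (hV : IsWeight M V)
    (hK : IsTemperedOp M V K) (hκV : ActsOnTempered M V κ)
    (hr : IsRapidlyDecreasing M V n (r * ρ)) (hf : IsTempered M V f) {t : ℝ} (ht : 0 ≤ t)
    {c : ℝ → ℝ} (hc : IntervalIntegrable c volume 0 t) :
    IntervalIntegrable
      (fun s => steadyAverage M ρ (fun x => r x * semigroup κ (t - s) f x) * c s) volume 0 t := by
  obtain ⟨L, hL⟩ := hκ.exists_lipschitzOnWith_steadyAverage hM hV hK hκV hr hf t
  refine hc.continuousOn_mul (hL.continuousOn.comp (by fun_prop) fun s hs => ?_)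
  rw [uIcc_of_le ht] at hs
  exact ⟨sub_nonneg.2 hs.2, sub_le_self t hs.1⟩

/-- `r` is the response function of the operator `D` in the steady state `ρ`: the adjoint of `D`
maps `ρ` to `r ρ`, without boundary terms when tested against tempered observables. -/
structure IsResponse (M : Set (State d)) (V ρ : State d → ℝ)
    (D : (State d → ℝ) → State d → ℝ) (r : State d → ℝ) : Prop where
  rapid : IsRapidlyDecreasing M V 0 (r * ρ)
  steadyAverage_eq : ∀ f, IsTempered M V f →
    steadyAverage M ρ (D f) = steadyAverage M ρ fun x => r x * f x

theorem isResponse_driftOp (hM : IsOpen M) (hV : IsWeight M V) (hρ : IsRapidlyDecreasing M V 1 ρ)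
    (hpos : ∀ x ∈ M, ρ x ≠ 0) {F' : Fin d → State d → ℝ} {i : Fin d}
    (hF' : IsTempered M V (F' i)) :
    IsResponse M V ρ (driftOp (F' i) i) (-driftResponse ρ F' i) := by
  refine ⟨?_, fun f hf => ?_⟩
  · exact ((isRapidlyDecreasing_driftResponse_mul hM hV hρ hpos hF').mul hM hV
      (isTempered_const (-1))).congr hM fun x _ => by
        rw [neg_mul, Pi.neg_apply, Pi.mul_apply (fun _ => (-1 : ℝ)) _ x, neg_one_mul]
  · rw [steadyAverage_driftOp hM hV hρ hpos hF' hf]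
    simp only [steadyAverage, Pi.neg_apply, neg_mul, integral_neg]

theorem isResponse_diffusionOp (hM : IsOpen M) (hV : IsWeight M V)
    (hρ : IsRapidlyDecreasing M V 2 ρ) (hpos : ∀ x ∈ M, ρ x ≠ 0) {σ' : Fin d → State d → ℝ}
    {i : Fin d} (hσ' : IsTempered M V (σ' i)) :
    IsResponse M V ρ (diffusionOp (fun x => σ' i x ^ 2) i) (noiseResponse ρ σ' i) :=
  ⟨isRapidlyDecreasing_noiseResponse_mul hM hV hρ hpos hσ',
    fun _ hf => steadyAverage_diffusionOp hM hV hρ hpos hσ' hf⟩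

theorem IsTemperedSystem.exists_abs_response_le {ι : Type*} [Fintype ι]
    {D : ι → (State d → ℝ) → State d → ℝ} {E : Set (Measure (State d))}
    (h : IsTemperedSystem M V K D E) (hκ : IsTransitionFunction M K κ)
    (hκV : ActsOnTempered M V κ) (hρ : IsSteadyState M κ ρ) {r : ι → State d → ℝ}
    (hr : ∀ j, IsResponse M V ρ (D j) (r j)) (hf : IsTempered M V f) (c : ι → ℝ → ℝ) (T : ℝ) :
    ∃ C : ℝ, ∀ (δ : ℝ) (μ : ℝ → Measure (State d)),
      IsPerturbedFlow M K (fun j s => δ * c j s) D E T (densityMeasure M ρ) μ → ∀ t ∈ Icc 0 T,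
        |∫ x, f x ∂(μ t) - steadyAverage M ρ (semigroup κ t f)
            - ∑ j, ∫ s in (0 : ℝ)..t,
                steadyAverage M ρ (fun x => r j x * semigroup κ (t - s) f x) * (δ * c j s)|
          ≤ C * δ ^ 2 := by
  have hadjoint : ∀ j q, 0 ≤ q → ∫ x, D j (semigroup κ q f) x ∂(densityMeasure M ρ)
      = steadyAverage M ρ fun x => r j x * semigroup κ q f x := fun j q hq => by
    rw [integral_densityMeasure h.isOpen hρ.smooth.continuousOn hρ.pos,
      (hr j).steadyAverage_eq _ (hκV.isTempered_semigroup hf hq)]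
  choose L hL using fun j =>
    hκ.exists_lipschitzOnWith_steadyAverage h.isOpen h.weight h.generator hκV (hr j).rapid hf T
  have hlip : ∀ j, LipschitzOnWith (Finset.univ.sup L)
      (fun q => ∫ x, D j (semigroup κ q f) x ∂(densityMeasure M ρ)) (Icc 0 T) :=
    fun j q hq q' hq' => by
      simp only [hadjoint j q hq.1, hadjoint j q' hq'.1]
      exact (hL j).weaken (Finset.le_sup (Finset.mem_univ j)) hq hq'
  obtain ⟨C, hC⟩ := h.exists_abs_linearResponse_le hκ hκV hρ.invariant hf hlip
  refine ⟨C * (∫ s in (0 : ℝ)..T, perturbationSize c s) ^ 2, fun δ μ hμ t ht => ?_⟩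
  have hbound := hC _ μ hμ t ht
  have hsize : ∀ s, perturbationSize (fun j s => δ * c j s) s = |δ| * perturbationSize c s :=
    fun s => by simp only [perturbationSize, abs_mul, Finset.mul_sum]
  have hresponse : ∫ s in (0 : ℝ)..t, ∑ j, δ * c j s
        * ∫ x, D j (semigroup κ (t - s) f) x ∂(densityMeasure M ρ)
      = ∑ j, ∫ s in (0 : ℝ)..t,
          steadyAverage M ρ (fun x => r j x * semigroup κ (t - s) f x) * (δ * c j s) := by
    rw [← intervalIntegral.integral_finsetSum fun j _ =>
      hκ.intervalIntegrable_steadyAverage_mul h.isOpen h.weight h.generator hκV (hr j).rapid hf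
        ht.1 (intervalIntegrable_of_mem_Icc (hμ.intervalIntegrable j) ⟨le_rfl, ht.1.trans ht.2⟩ ht)]
    refine intervalIntegral.integral_congr fun s hs => ?_
    rw [uIcc_of_le ht.1] at hs
    simp only [hadjoint _ _ (sub_nonneg.2 hs.2), mul_comm]
  simp only [hsize, intervalIntegral.integral_const_mul, mul_pow, sq_abs] at hbound
  rw [integral_densityMeasure h.isOpen hρ.smooth.continuousOn hρ.pos, hresponse] at hbound
  exact hbound.trans_eq (by ring)

end SteadyState

section DiagonalPerturbation

variable {d : ℕ} {M : Set (State d)} {V ρ f : State d → ℝ} {F' σ' : Fin d → State d → ℝ}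
  {K : (State d → ℝ) → State d → ℝ} {κ : ℝ → Kernel (State d) (State d)}

/-- The operators `F̃ᵢ ∂ᵢ` and `σ̃ᵢ² ∂ᵢ²` of the perturbation, as one family. -/
noncomputable def diagonalOp (F' σ' : Fin d → State d → ℝ) :
    Fin d ⊕ Fin d → (State d → ℝ) → State d → ℝ :=
  Sum.elim (fun i => driftOp (F' i) i) fun i => diffusionOp (fun x => σ' i x ^ 2) i

/-- The amplitudes `Gᵢ` and `Hᵢ²` of the perturbation, as one family. -/
def diagonalAmplitude (G H : Fin d → ℝ → ℝ) : Fin d ⊕ Fin d → ℝ → ℝ :=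
  Sum.elim G fun i s => H i s ^ 2

/-- The response functions of the operators in `diagonalOp`. -/
noncomputable def diagonalResponse (ρ : State d → ℝ) (F' σ' : Fin d → State d → ℝ) :
    Fin d ⊕ Fin d → State d → ℝ :=
  Sum.elim (fun i => -driftResponse ρ F' i) (noiseResponse ρ σ')

theorem perturbedGenerator_eq_perturbedOp (F σ F' σ' : Fin d → State d → ℝ) (G H : Fin d → ℝ → ℝ)
    (δ : ℝ) :
    perturbedGenerator F σ F' σ' G H δ
      = perturbedOp (generator F σ) (fun j s => δ * diagonalAmplitude G H j s)
          (diagonalOp F' σ') := by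
  funext t f x
  simp only [perturbedGenerator, perturbedOp, generator, kolmogorovOp, diagonalOp,
    diagonalAmplitude, Fintype.sum_sum_type, Sum.elim_inl, Sum.elim_inr, driftOp, diffusionOp,
    ← Finset.sum_add_distrib]
  exact Finset.sum_congr rfl fun i _ => by ring

theorem isTemperedOp_diagonalOp (hM : IsOpen M) (hV : ∀ x ∈ M, 1 ≤ V x)
    (hF' : ∀ i, IsTempered M V (F' i)) (hσ' : ∀ i, IsTempered M V (σ' i)) (j : Fin d ⊕ Fin d) :
    IsTemperedOp M V (diagonalOp F' σ' j) := by
  rcases j with i | i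
  · exact isTemperedOp_driftOp hM hV (hF' i) i
  · exact isTemperedOp_diffusionOp hM hV ((hσ' i).pow hM hV 2) i

theorem isResponse_diagonalOp (hM : IsOpen M) (hV : IsWeight M V)
    (hρ : IsRapidlyDecreasing M V 2 ρ) (hpos : ∀ x ∈ M, ρ x ≠ 0)
    (hF' : ∀ i, IsTempered M V (F' i)) (hσ' : ∀ i, IsTempered M V (σ' i)) (j : Fin d ⊕ Fin d) :
    IsResponse M V ρ (diagonalOp F' σ' j) (diagonalResponse ρ F' σ' j) := by
  rcases j with i | i
  · exact isResponse_driftOp hM hV (hρ.of_le one_le_two) hpos (hF' i)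
  · exact isResponse_diffusionOp hM hV hρ hpos (hσ' i)

theorem sum_integral_diagonalResponse (w : ℝ → State d → ℝ) (G H : Fin d → ℝ → ℝ) (δ t : ℝ) :
    ∑ j, ∫ s in (0 : ℝ)..t, steadyAverage M ρ (fun x => diagonalResponse ρ F' σ' j x * w s x)
        * (δ * diagonalAmplitude G H j s)
      = -(∑ i, ∫ s in (0 : ℝ)..t,
            steadyAverage M ρ (fun x => driftResponse ρ F' i x * w s x) * (δ * G i s))
        + ∑ i, ∫ s in (0 : ℝ)..t,
            steadyAverage M ρ (fun x => noiseResponse ρ σ' i x * w s x) * (δ * H i s ^ 2) := by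
  simp only [Fintype.sum_sum_type, diagonalResponse, diagonalAmplitude, Sum.elim_inl,
    Sum.elim_inr, steadyAverage, Pi.neg_apply, neg_mul, integral_neg,
    intervalIntegral.integral_neg, Finset.sum_neg_distrib]

theorem isPerturbedFlow_diagonalOp {F σ : Fin d → State d → ℝ} {G H : Fin d → ℝ → ℝ}
    {E : Set (Measure (State d))} {δ T : ℝ} {μ₀ : Measure (State d)} {μ : ℝ → Measure (State d)}
    (hG : ∀ i, IntervalIntegrable (G i) volume 0 T)
    (hH : ∀ i, IntervalIntegrable (fun s => H i s ^ 2) volume 0 T)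
    (hμ : IsFokkerPlanckSolution M (perturbedGenerator F σ F' σ' G H δ) μ₀ μ)
    (hE : ∀ t ∈ Icc 0 T, μ t ∈ E) :
    IsPerturbedFlow M (generator F σ) (fun j s => δ * diagonalAmplitude G H j s)
      (diagonalOp F' σ') E T μ₀ μ where
  intervalIntegrable := Sum.forall.2 ⟨fun i => (hG i).const_mul δ, fun i => (hH i).const_mul δ⟩
  solution := perturbedGenerator_eq_perturbedOp F σ F' σ' G H δ ▸ hμ
  mem := hE

theorem IsTransitionFunction.exists_abs_diagonalResponse_le {E : Set (Measure (State d))}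
    (hκ : IsTransitionFunction M K κ) (hM : IsOpen M) (hV : IsWeight M V)
    (hK : IsTemperedOp M V K) (hκV : ActsOnTempered M V κ) (hρ : IsSteadyState M κ ρ)
    (hρV : IsRapidlyDecreasing M V 2 ρ) (hF' : ∀ i, IsTempered M V (F' i))
    (hσ' : ∀ i, IsTempered M V (σ' i)) (hE : HasBoundedMoments M V E) (hf : IsTempered M V f)
    (G H : Fin d → ℝ → ℝ) (T : ℝ) :
    ∃ C : ℝ, ∀ (δ : ℝ) (μ : ℝ → Measure (State d)),
      IsPerturbedFlow M K (fun j s => δ * diagonalAmplitude G H j s) (diagonalOp F' σ') E T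
        (densityMeasure M ρ) μ → ∀ t ∈ Icc 0 T,
        |∫ x, f x ∂(μ t) - steadyAverage M ρ (semigroup κ t f)
          - (-(∑ i, ∫ s in (0 : ℝ)..t,
                steadyAverage M ρ (fun x => driftResponse ρ F' i x * semigroup κ (t - s) f x)
                  * (δ * G i s))
            + ∑ i, ∫ s in (0 : ℝ)..t,
                steadyAverage M ρ (fun x => noiseResponse ρ σ' i x * semigroup κ (t - s) f x)
                  * (δ * H i s ^ 2))| ≤ C * δ ^ 2 := by
  have h : IsTemperedSystem M V K (diagonalOp F' σ') E :=
    ⟨hM, hV, hK, isTemperedOp_diagonalOp hM hV.one_le hF' hσ', hE⟩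
  simpa only [fun (δ t : ℝ) => sum_integral_diagonalResponse (M := M) (ρ := ρ) (F' := F')
    (σ' := σ') (fun s => semigroup κ (t - s) f) G H δ t] using h.exists_abs_response_le hκ hκV hρ
      (isResponse_diagonalOp hM hV hρV (fun x hx => (hρ.pos x hx).ne') hF' hσ') hf
      (diagonalAmplitude G H) T

theorem sum_driftResponse (ρ : State d → ℝ) (F' : Fin d → State d → ℝ) (x : State d) :
    ∑ i, driftResponse ρ F' i x = driftResponseVec ρ F' x := by
  simp only [driftResponse, driftResponseVec, divergence, Finset.mul_sum]

theorem sum_noiseResponse (ρ : State d → ℝ) (σ' : Fin d → State d → ℝ) (x : State d) :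
    ∑ i, noiseResponse ρ σ' i x = noiseResponseVec ρ σ' x := by
  simp only [noiseResponse, noiseResponseVec, divergence, noiseOp, Finset.mul_sum,
    Finset.sum_add_distrib, mul_assoc]
  rfl

theorem IsTransitionFunction.sum_integral_steadyAverage_mul {ι : Type*} [Fintype ι] {n : ℕ}
    (hκ : IsTransitionFunction M K κ) (hM : IsOpen M) (hV : IsWeight M V)
    (hK : IsTemperedOp M V K) (hκV : ActsOnTempered M V κ) {r : ι → State d → ℝ}
    (hr : ∀ j, IsRapidlyDecreasing M V n (r j * ρ)) (hf : IsTempered M V f) {t : ℝ} (ht : 0 ≤ t)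
    {c : ι → ℝ → ℝ} (hc : ∀ j, IntervalIntegrable (c j) volume 0 t) {b : ℝ → ℝ}
    (hcb : ∀ j s, 0 ≤ s → c j s = b s) :
    ∑ j, ∫ s in (0 : ℝ)..t,
        steadyAverage M ρ (fun x => r j x * semigroup κ (t - s) f x) * c j s
      = ∫ s in (0 : ℝ)..t,
        steadyAverage M ρ (fun x => (∑ j, r j x) * semigroup κ (t - s) f x) * b s := by
  rw [← intervalIntegral.integral_finsetSum fun j _ =>
    hκ.intervalIntegrable_steadyAverage_mul hM hV hK hκV (hr j) hf ht (hc j)]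
  refine intervalIntegral.integral_congr fun s hs => ?_
  rw [uIcc_of_le ht] at hs
  have hint : ∀ j, IntegrableOn (fun x => r j x * semigroup κ (t - s) f x * ρ x) M := fun j =>
    (hr j).integrableOn_mul_mul hM hV (hκV.isTempered_semigroup hf (sub_nonneg.2 hs.2))
  simp only [steadyAverage, Finset.sum_mul, hcb _ s hs.1]
  rw [integral_finsetSum _ fun j _ => hint j, Finset.sum_mul]

end DiagonalPerturbation

theorem theorem1 {d : ℕ} (M : Set (State d)) (hM : IsOpen M)
    (V : State d → ℝ) (hV : IsWeight M V)
    -- the unperturbed system, its Markov semigroup and its steady state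
    (F σ : Fin d → State d → ℝ)
    (hF : ∀ i, IsTempered M V (F i)) (hσ : ∀ i, IsTempered M V (σ i))
    (κ : ℝ → Kernel (State d) (State d))
    (hκ : IsTransitionFunction M (generator F σ) κ) (hκV : ActsOnTempered M V κ)
    (ρ : State d → ℝ) (hρ : IsSteadyState M κ ρ) (hρV : DecaysAtBoundary M V ρ)
    -- the perturbation
    (F' σ' : Fin d → State d → ℝ)
    (hF' : ∀ i, IsTempered M V (F' i)) (hσ' : ∀ i, IsTempered M V (σ' i))
    (G H : Fin d → ℝ → ℝ)
    (hG : ∀ i, ∀ t, 0 ≤ t → IntervalIntegrable (G i) volume 0 t)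
    (hH : ∀ i, ∀ t, 0 ≤ t → IntervalIntegrable (fun s => H i s ^ 2) volume 0 t)
    -- the laws of the perturbed system, started from the steady state
    (δ₀ : ℝ) (hδ₀ : 0 < δ₀) (μ : ℝ → ℝ → Measure (State d))
    (hμ : ∀ δ ∈ Ioc 0 δ₀, IsFokkerPlanckSolution M (perturbedGenerator F σ F' σ' G H δ)
      (densityMeasure M ρ) (μ δ))
    (hμV : ∀ (k : ℕ) (T : ℝ), ∃ C : ℝ, ∀ δ ∈ Ioc 0 δ₀, ∀ t ∈ Icc 0 T,
      Integrable (fun x => V x ^ k) (μ δ t) ∧ ∫ x, V x ^ k ∂(μ δ t) ≤ C)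
    -- the observable
    (u : State d → ℝ) (hu : IsTempered M V u) :
    -- all averages and time integrals exist
    (∀ t, 0 ≤ t → IntegrableOn (fun x => semigroup κ t u x * ρ x) M ∧
      ∀ δ ∈ Ioc 0 δ₀, Integrable u (μ δ t)) ∧
    (∀ i, ∀ t, 0 ≤ t →
      IntegrableOn (fun x => driftResponse ρ F' i x * semigroup κ t u x * ρ x) M ∧
      IntegrableOn (fun x => noiseResponse ρ σ' i x * semigroup κ t u x * ρ x) M ∧
      IntervalIntegrable (fun s =>
        steadyAverage M ρ (fun x => driftResponse ρ F' i x * semigroup κ (t - s) u x) * G i s)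
        volume 0 t ∧
      IntervalIntegrable (fun s =>
        steadyAverage M ρ (fun x => noiseResponse ρ σ' i x * semigroup κ (t - s) u x) * H i s ^ 2)
        volume 0 t) ∧
    -- the componentwise formula
    (∀ T : ℝ, ∃ C : ℝ, ∀ δ ∈ Ioc 0 δ₀, ∀ t ∈ Icc 0 T,
      |(∫ x, u x ∂(μ δ t)) - steadyAverage M ρ (semigroup κ t u)
        - (-(∑ i, ∫ s in (0 : ℝ)..t,
              steadyAverage M ρ (fun x => driftResponse ρ F' i x * semigroup κ (t - s) u x)
                * (δ * G i s))
          + ∑ i, ∫ s in (0 : ℝ)..t,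
              steadyAverage M ρ (fun x => noiseResponse ρ σ' i x * semigroup κ (t - s) u x)
                * (δ * H i s ^ 2))| ≤ C * δ ^ 2) ∧
    -- the vector form for homogeneous perturbations
    (∀ g h : ℝ → ℝ, (∀ i, ∀ s, 0 ≤ s → G i s = g s) → (∀ i, ∀ s, 0 ≤ s → H i s = h s) →
      ∀ T : ℝ, ∃ C : ℝ, ∀ δ ∈ Ioc 0 δ₀, ∀ t ∈ Icc 0 T,
      |(∫ x, u x ∂(μ δ t)) - steadyAverage M ρ (semigroup κ t u)
        - (-(∫ s in (0 : ℝ)..t,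
              steadyAverage M ρ (fun x => driftResponseVec ρ F' x * semigroup κ (t - s) u x)
                * (δ * g s))
          + ∫ s in (0 : ℝ)..t,
              steadyAverage M ρ (fun x => noiseResponseVec ρ σ' x * semigroup κ (t - s) u x)
                * (δ * h s ^ 2))| ≤ C * δ ^ 2) := by
  have hK : IsTemperedOp M V (generator F σ) :=
    isTemperedOp_kolmogorovOp hM hV.one_le hF fun i => (hσ i).pow hM hV.one_le 2
  have hE : ∀ T, HasBoundedMoments M V (image2 μ (Ioc 0 δ₀) (Icc 0 T)) := fun T =>
    ⟨forall_mem_image2.2 fun δ hδ t ht => (hμ δ hδ).mem t ht.1, fun k =>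
      (hμV k T).imp fun C hC => forall_mem_image2.2 hC⟩
  have hρ2 : IsRapidlyDecreasing M V 2 ρ := ⟨hρ.smooth, hρV⟩
  have hρ0 : ∀ x ∈ M, ρ x ≠ 0 := fun x hx => (hρ.pos x hx).ne'
  have hdrift := fun i => isRapidlyDecreasing_driftResponse_mul hM hV hρ2 hρ0 (hF' i)
  have hnoise := fun i => isRapidlyDecreasing_noiseResponse_mul (n := 0) hM hV hρ2 hρ0 (hσ' i)
  have hut : ∀ t, 0 ≤ t → IsTempered M V (semigroup κ t u) := fun t => hκV.isTempered_semigroup hu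
  have hexpansion := fun T => (hκ.exists_abs_diagonalResponse_le hM hV hK hκV hρ hρ2 hF' hσ'
    (hE |T|) hu G H |T|).imp fun C hC δ (hδ : δ ∈ Ioc 0 δ₀) t (ht : t ∈ Icc 0 T) =>
      hC δ (μ δ) (isPerturbedFlow_diagonalOp (hG · _ (abs_nonneg T)) (hH · _ (abs_nonneg T))
        (hμ δ hδ) fun s hs => mem_image2_of_mem hδ hs) t ⟨ht.1, ht.2.trans (le_abs_self T)⟩
  refine ⟨fun t ht => ⟨hρ2.integrableOn_mul hM hV (hut t ht), fun δ hδ =>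
      (hE t).integrable hM hV.one_le (mem_image2_of_mem hδ ⟨ht, le_rfl⟩) hu⟩, fun i t ht =>
    ⟨(hdrift i).integrableOn_mul_mul hM hV (hut t ht),
      (hnoise i).integrableOn_mul_mul hM hV (hut t ht),
      hκ.intervalIntegrable_steadyAverage_mul hM hV hK hκV (hdrift i) hu ht (hG i t ht),
      hκ.intervalIntegrable_steadyAverage_mul hM hV hK hκV (hnoise i) hu ht (hH i t ht)⟩,
    hexpansion, fun g h hg hh T => (hexpansion T).imp fun C hC δ hδ t ht => ?_⟩
  simp only [← sum_driftResponse, ← sum_noiseResponse]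
  rw [← hκ.sum_integral_steadyAverage_mul hM hV hK hκV hdrift hu ht.1
      (fun i => (hG i t ht.1).const_mul δ) fun i s hs => by rw [hg i s hs],
    ← hκ.sum_integral_steadyAverage_mul hM hV hK hκV hnoise hu ht.1
      (fun i => (hH i t ht.1).const_mul δ) fun i s hs => by rw [hh i s hs]]
  exact hC δ hδ t ht
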